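/- Let $L>0$ and $a>0$, and let $\Omega=(\mathbb R/L\mathbb Z)^2\times[0,a]$ be the finite slab with periodic lateral variables $x,y$ and perfectly conducting plates at $z=0$ and $z=a$. Let $H_0(\mathrm{curl};\Omega)$ be the closure, in the graph norm $\left(\|E\|_{L^2}^2+\|\nabla\times E\|_{L^2}^2\right)^{1/2}$, of the smooth laterally periodic fields $E:\Omega\to\mathbb C^3$ with $E_x=E_y=0$ at $z=0,a$. Put $$V_{\mathrm{PEC}}=\{E\in H_0(\mathrm{curl};\Omega):\nabla\cdot E=0 \text{ in the sense of distributions}\},\qquad \mathcal H_{\mathrm{PEC}}=\overline{V_{\mathrm{PEC}}}^{\,L^2(\Omega;\mathbb C^3)},$$ $h_0=(L^2a)^{-1/2}e_z$, $\mathcal H_{\mathrm{phys}}=\mathcal H_{\mathrm{PEC}}\ominus\operatorname{span}\{h_0\}$ and $V_{\mathrm{phys}}=V_{\mathrm{PEC}}\cap\mathcal H_{\mathrm{phys}}$. Let $\mathcal L_{\mathrm{Mx}}$ be the nonnegative self-adjoint operator on $\mathcal H_{\mathrm{phys}}$ associated with the closed form $q[E,F]=\int_\Omega(\nabla\times E)\cdot\overline{(\nabla\times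 F)}\,dx$, $E,F\in V_{\mathrm{phys}}$: its domain consists of those $E\in V_{\mathrm{phys}}$ for which there is $G\in\mathcal H_{\mathrm{phys}}$ with $q[E,F]=\langle G,F\rangle$ for all $F\in V_{\mathrm{phys}}$, and then $\mathcal L_{\mathrm{Mx}}E=G$. Then for every $\tau>0$ and every $p\ge0$ the operator $\mathcal L_{\mathrm{Mx}}^pe^{-\tau\mathcal L_{\mathrm{Mx}}}$ is positive and has finite trace, $$\operatorname{Tr}\left(\mathcal L_{\mathrm{Mx}}^pe^{-\tau\mathcal L_{\mathrm{Mx}}}\right)<\infty .$$ Explicitly, with $k_m=\frac{2\pi}{L}m$ for $m\in\mathbb Z^2$ and $\nu_n=\frac{\pi n}{a}$, $$\operatorname{Tr}\left(\mathcal L_{\mathrm{Mx}}^pe^{-\tau\mathcal L_{\mathrm{Mx}}}\right)=2\sum_{m\in\mathbb Z^2}\sum_{n=1}^\infty\left(|k_m|^2+\nu_n^2\right)^pe^{-\tau(|k_m|^2+\nu_n^2)}+\sum_{m\in\mathbb Z^2\setminus\{0\}}|k_m|^{2p}e^{-\tau|k_m|^2}.$$ In particular $\operatorname{Tr}(e^{-\tau\mathcal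 L_{\mathrm{Mx}}})$, $\operatorname{Tr}(\mathcal L_{\mathrm{Mx}}^{1/2}e^{-\tau\mathcal L_{\mathrm{Mx}}})$ and $\operatorname{Tr}(\mathcal L_{\mathrm{Mx}}^{3/2}e^{-\tau\mathcal L_{\mathrm{Mx}}})$ are finite. -/

import Mathlib

open MeasureTheory Set
open scoped ContDiff ENNReal InnerProductSpace

namespace MaxwellSlab

noncomputable section

/-- Points `(x, y, z)` of `ℝ³`. -/
abbrev Pt : Type := Fin 3 → ℝ

/-- Complex field values, with the Hermitian norm of `ℂ³`. -/
abbrev Vec : Type := EuclideanSpace ℂ (Fin 3)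

/-- The open box `(0, L) × (0, L) × (0, a)`, a fundamental domain (up to a null set) of the slab
`(ℝ/Lℤ)² × [0, a]`.  Fields on the slab are fields on this box; lateral periodicity is carried by
the smooth fields and test functions below. -/
def slab (L a : ℝ) : Set Pt :=
  Set.univ.pi fun i => Set.Ioo 0 ((![L, L, a] : Fin 3 → ℝ) i)

/-- The Hilbert space `L²(Ω; ℂ³)` of the slab `Ω = (ℝ/Lℤ)² × [0, a]`. -/
abbrev L2Field (L a : ℝ) : Type := Lp Vec 2 (volume.restrict (slab L a))

/-- Smooth functions that are `L`-periodic in `x` and in `y`.  Their restrictions to `0 ≤ z ≤ a` are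
exactly the functions on `(ℝ/Lℤ)² × [0, a]` that are smooth up to the plates. -/
structure IsSmoothPeriodic {F : Type} [NormedAddCommGroup F] [NormedSpace ℝ F]
    (L : ℝ) (f : Pt → F) : Prop where
  contDiff : ContDiff ℝ ∞ f
  periodic_x : ∀ x, f (x + Pi.single 0 L) = f x
  periodic_y : ∀ x, f (x + Pi.single 1 L) = f x

/-- The support in the plate variable `z` is a compact subset of `(0, a)`. -/
def VanishesNearPlates {F : Type} [Zero F] (a : ℝ) (f : Pt → F) : Prop :=
  ∃ δ > 0, ∀ x : Pt, (x 2 < δ ∨ a - δ < x 2) → f x = 0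

/-- The classical partial derivative in the `i`-th coordinate direction. -/
def partialDeriv (i : Fin 3) (f : Pt → ℂ) (x : Pt) : ℂ := fderiv ℝ f x (Pi.single i 1)

/-- The classical gradient. -/
def grad (f : Pt → ℂ) (x : Pt) : Vec :=
  !₂[partialDeriv 0 f x, partialDeriv 1 f x, partialDeriv 2 f x]

/-- The classical curl. -/
def curl (E : Pt → Vec) (x : Pt) : Vec :=
  !₂[partialDeriv 1 (fun y => E y 2) x - partialDeriv 2 (fun y => E y 1) x,
     partialDeriv 2 (fun y => E y 0) x - partialDeriv 0 (fun y => E y 2) x,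
     partialDeriv 0 (fun y => E y 1) x - partialDeriv 1 (fun y => E y 0) x]

/-- `∇ × E = C` in the sense of distributions on the slab (with lateral periodicity).  The inner
product of Mathlib is conjugate linear in its first argument, so this reads
`∫ E · conj (∇ × Φ) = ∫ C · conj Φ`. -/
def HasWeakCurl (L a : ℝ) (E C : L2Field L a) : Prop :=
  ∀ Φ : Pt → Vec, IsSmoothPeriodic L Φ → VanishesNearPlates a Φ →
    ∫ x in slab L a, ⟪curl Φ x, E x⟫_ℂ = ∫ x in slab L a, ⟪Φ x, C x⟫_ℂ

/-- `∇ · E = 0` in the sense of distributions on the slab (with lateral periodicity):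
`∫ E · conj (∇ φ) = 0`. -/
def IsWeaklyDivFree (L a : ℝ) (E : L2Field L a) : Prop :=
  ∀ φ : Pt → ℂ, IsSmoothPeriodic L φ → VanishesNearPlates a φ →
    ∫ x in slab L a, ⟪grad φ x, E x⟫_ℂ = 0

instance isFiniteMeasure_slab (L a : ℝ) : IsFiniteMeasure (volume.restrict (slab L a)) := by
  refine ⟨?_⟩
  rw [Measure.restrict_apply_univ]
  refine lt_of_le_of_lt (measure_mono (t := Set.Icc 0 ![L, L, a]) ?_)
    isCompact_Icc.measure_lt_top
  intro x hx
  exact ⟨fun i => (hx i (mem_univ i)).1.le, fun i => (hx i (mem_univ i)).2.le⟩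

theorem memLp_slab (L a : ℝ) {f : Pt → Vec} (hf : Continuous f) :
    MemLp f 2 (volume.restrict (slab L a)) := by
  obtain ⟨K, hK⟩ := (isCompact_Icc (a := (0 : Pt)) (b := ![L, L, a])).exists_bound_of_continuousOn
    hf.continuousOn
  refine MemLp.of_bound hf.aestronglyMeasurable K ?_
  refine (ae_restrict_iff' (MeasurableSet.univ_pi fun i => measurableSet_Ioo)).2 ?_
  refine Filter.Eventually.of_forall fun x hx => hK x ?_
  exact ⟨fun i => (hx i (mem_univ i)).1.le, fun i => (hx i (mem_univ i)).2.le⟩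

theorem integral_inner_eq (L a : ℝ) {f : Pt → Vec} (hf : Continuous f) (E : L2Field L a) :
    ∫ x in slab L a, ⟪f x, E x⟫_ℂ = ⟪(memLp_slab L a hf).toLp f, E⟫_ℂ := by
  rw [L2.inner_def]
  refine integral_congr_ae ?_
  filter_upwards [(memLp_slab L a hf).coeFn_toLp] with x hx
  rw [hx]

theorem contDiff_coord {E : Pt → Vec} (hE : ContDiff ℝ ∞ E) (j : Fin 3) :
    ContDiff ℝ ∞ (fun x => E x j) := by
  have : (fun x => E x j) = fun x => (EuclideanSpace.proj (𝕜 := ℂ) j).restrictScalars ℝ (E x) := rfl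
  rw [this]
  exact (ContinuousLinearMap.contDiff _).comp hE

theorem contDiff_partialDeriv {f : Pt → ℂ} (hf : ContDiff ℝ ∞ f) (i : Fin 3) :
    ContDiff ℝ ∞ (partialDeriv i f) :=
  (contDiff_infty_iff_fderiv.1 hf).2.clm_apply contDiff_const

theorem continuous_curl {E : Pt → Vec} (hE : ContDiff ℝ ∞ E) : Continuous (curl E) := by
  have h := fun i j => (contDiff_partialDeriv (contDiff_coord hE j) i).continuous
  refine (PiLp.continuous_toLp 2 _).comp (continuous_pi fun i => ?_)
  fin_cases i
  · exact (h 1 2).sub (h 2 1)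
  · exact (h 2 0).sub (h 0 2)
  · exact (h 0 1).sub (h 1 0)

theorem continuous_grad {f : Pt → ℂ} (hf : ContDiff ℝ ∞ f) : Continuous (grad f) := by
  have h := fun i => (contDiff_partialDeriv hf i).continuous
  refine (PiLp.continuous_toLp 2 _).comp (continuous_pi fun i => ?_)
  fin_cases i
  · exact h 0
  · exact h 1
  · exact h 2

theorem curl_add {E F : Pt → Vec} (hE : ContDiff ℝ ∞ E) (hF : ContDiff ℝ ∞ F) :
    curl (E + F) = curl E + curl F := by
  have h : ∀ i j x, partialDeriv i (fun y => E y j + F y j) x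
      = partialDeriv i (fun y => E y j) x + partialDeriv i (fun y => F y j) x := by
    intro i j x
    have h1 := ((contDiff_coord hE j).differentiable (by simp)).differentiableAt (x := x)
    have h2 := ((contDiff_coord hF j).differentiable (by simp)).differentiableAt (x := x)
    have := fderiv_add h1 h2
    unfold partialDeriv
    change fderiv ℝ ((fun y => E y j) + fun y => F y j) x _ = _
    rw [this]; rfl
  ext x i
  fin_cases i <;> simp [curl, h] <;> ring

theorem curl_smul (c : ℂ) {E : Pt → Vec} (hE : ContDiff ℝ ∞ E) :
    curl (c • E) = c • curl E := by
  have h : ∀ i j x, partialDeriv i (fun y => c * E y j) x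
      = c * partialDeriv i (fun y => E y j) x := by
    intro i j x
    have h1 := ((contDiff_coord hE j).differentiable (by simp)).differentiableAt (x := x)
    unfold partialDeriv
    rw [fderiv_const_mul h1]; rfl
  ext x i
  fin_cases i <;> simp [curl, h] <;> ring

/-- The pairs `(E, ∇ × E)` with `E` smooth up to the plates, laterally periodic, and with
`E_x = E_y = 0` on the plates `z = 0` and `z = a`.  The norm of the ambient Hilbert space
`L² ⊕ L²` restricts to the graph norm of `H(curl)`. -/
def smoothPECGraph (L a : ℝ) : Submodule ℂ (WithLp 2 (L2Field L a × L2Field L a)) where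
  carrier := {p | ∃ E : Pt → Vec, IsSmoothPeriodic L E ∧
    (∀ x : Pt, (x 2 = 0 ∨ x 2 = a) → E x 0 = 0 ∧ E x 1 = 0) ∧
    p.fst =ᵐ[volume.restrict (slab L a)] E ∧ p.snd =ᵐ[volume.restrict (slab L a)] curl E}
  zero_mem' := by
    refine ⟨0, ⟨contDiff_const, fun _ => rfl, fun _ => rfl⟩, fun _ _ => ⟨rfl, rfl⟩,
      Lp.coeFn_zero _ _ _, ?_⟩
    have h0 : curl 0 = 0 := by
      have := curl_smul 0 (E := 0) contDiff_const
      simpa using this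
    rw [h0]
    exact Lp.coeFn_zero _ _ _
  add_mem' := by
    rintro p q ⟨E, hE, hE0, hp1, hp2⟩ ⟨F, hF, hF0, hq1, hq2⟩
    refine ⟨E + F, ⟨hE.contDiff.add hF.contDiff, fun x => ?_, fun x => ?_⟩, fun x hx => ?_, ?_, ?_⟩
    · simp [hE.periodic_x, hF.periodic_x]
    · simp [hE.periodic_y, hF.periodic_y]
    · simp [hE0 x hx, hF0 x hx]
    · exact (Lp.coeFn_add _ _).trans (hp1.add hq1)
    · rw [curl_add hE.contDiff hF.contDiff]
      exact (Lp.coeFn_add _ _).trans (hp2.add hq2)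
  smul_mem' := by
    rintro c p ⟨E, hE, hE0, hp1, hp2⟩
    refine ⟨c • E, ⟨hE.contDiff.const_smul c, fun x => ?_, fun x => ?_⟩, fun x hx => ?_, ?_, ?_⟩
    · simp [hE.periodic_x]
    · simp [hE.periodic_y]
    · simp [hE0 x hx]
    · exact (Lp.coeFn_smul _ _).trans (hp1.const_smul c)
    · rw [curl_smul c hE.contDiff]
      exact (Lp.coeFn_smul _ _).trans (hp2.const_smul c)

/-- The graph of the curl over the perfect-conductor form domain: the pairs `(E, C)` such that `E`
has weak curl `C` in `L²`, `E` is the limit in the `H(curl)` graph norm of smooth fields with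
vanishing tangential components on the plates, and `E` is divergence free in the sense of
distributions. -/
def pecGraph (L a : ℝ) : Submodule ℂ (WithLp 2 (L2Field L a × L2Field L a)) where
  carrier := {p | HasWeakCurl L a p.fst p.snd ∧ p ∈ (smoothPECGraph L a).topologicalClosure ∧
    IsWeaklyDivFree L a p.fst}
  zero_mem' := by
    refine ⟨fun Φ hΦ _ => ?_, Submodule.zero_mem _, fun φ hφ _ => ?_⟩
    · rw [integral_inner_eq L a (continuous_curl hΦ.contDiff),
        integral_inner_eq L a hΦ.contDiff.continuous]
      simp
    · rw [integral_inner_eq L a (continuous_grad hφ.contDiff)]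
      simp
  add_mem' := by
    rintro p q ⟨hp1, hp2, hp3⟩ ⟨hq1, hq2, hq3⟩
    refine ⟨fun Φ hΦ h0 => ?_, Submodule.add_mem _ hp2 hq2, fun φ hφ h0 => ?_⟩
    · have h1 := hp1 Φ hΦ h0
      have h2 := hq1 Φ hΦ h0
      rw [integral_inner_eq L a (continuous_curl hΦ.contDiff),
        integral_inner_eq L a hΦ.contDiff.continuous] at h1 h2 ⊢
      simp [inner_add_right, h1, h2]
    · have h1 := hp3 φ hφ h0
      have h2 := hq3 φ hφ h0
      rw [integral_inner_eq L a (continuous_grad hφ.contDiff)] at h1 h2 ⊢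
      simp [inner_add_right, h1, h2]
  smul_mem' := by
    rintro c p ⟨hp1, hp2, hp3⟩
    refine ⟨fun Φ hΦ h0 => ?_, Submodule.smul_mem _ c hp2, fun φ hφ h0 => ?_⟩
    · have h1 := hp1 Φ hΦ h0
      rw [integral_inner_eq L a (continuous_curl hΦ.contDiff),
        integral_inner_eq L a hΦ.contDiff.continuous] at h1 ⊢
      simp [inner_smul_right, h1]
    · have h1 := hp3 φ hφ h0
      rw [integral_inner_eq L a (continuous_grad hφ.contDiff)] at h1 ⊢
      simp [inner_smul_right, h1]

theorem isClosed_pecGraph (L a : ℝ) :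
    IsClosed (pecGraph L a : Set (WithLp 2 (L2Field L a × L2Field L a))) := by
  have hf : Continuous fun p : WithLp 2 (L2Field L a × L2Field L a) => p.fst :=
    (WithLp.fstL 2 ℂ (L2Field L a) (L2Field L a)).continuous
  have hs : Continuous fun p : WithLp 2 (L2Field L a × L2Field L a) => p.snd :=
    (WithLp.sndL 2 ℂ (L2Field L a) (L2Field L a)).continuous
  have h1 : IsClosed {p : WithLp 2 (L2Field L a × L2Field L a) |
      HasWeakCurl L a p.fst p.snd} := by
    simp only [HasWeakCurl, ofPred_forall]
    refine isClosed_iInter fun Φ => isClosed_iInter fun hΦ => isClosed_iInter fun _ => ?_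
    simp only [integral_inner_eq L a (continuous_curl hΦ.contDiff),
        integral_inner_eq L a hΦ.contDiff.continuous]
    exact isClosed_eq (continuous_const.inner hf) (continuous_const.inner hs)
  have h2 : IsClosed {p : WithLp 2 (L2Field L a × L2Field L a) |
      IsWeaklyDivFree L a p.fst} := by
    simp only [IsWeaklyDivFree, ofPred_forall]
    refine isClosed_iInter fun φ => isClosed_iInter fun hφ => isClosed_iInter fun _ => ?_
    simp only [integral_inner_eq L a (continuous_grad hφ.contDiff)]
    exact isClosed_eq (continuous_const.inner hf) continuous_const
  exact h1.inter ((Submodule.isClosed_topologicalClosure _).inter h2)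

theorem integral_partialDeriv_eq_zero {L a : ℝ} (hL : 0 < L) (ha : 0 < a) {f : Pt → ℂ}
    (hf : IsSmoothPeriodic L f) (hf0 : VanishesNearPlates a f) (i : Fin 3) :
    ∫ x in slab L a, partialDeriv i f x = 0 := by
  have hae : slab L a =ᵐ[volume] Set.Icc (0 : Pt) ![L, L, a] := by
    rw [volume_pi]
    exact Measure.univ_pi_Ioo_ae_eq_Icc
  have hle : (0 : Pt) ≤ ![L, L, a] := by
    intro j; fin_cases j <;> simp [hL.le, ha.le]
  obtain ⟨δ, hδ, h0⟩ := hf0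
  have hd : ∀ x, HasFDerivAt f (fderiv ℝ f x) x := fun x =>
    (hf.contDiff.differentiable (by simp) x).hasFDerivAt
  have key := integral_divergence_of_hasFDerivAt_off_countable' (n := 2) (0 : Pt) ![L, L, a] hle
    (fun j => if j = i then f else 0) (fun j x => if j = i then fderiv ℝ f x else 0) ∅
    countable_empty
    (fun j => by
      by_cases h : j = i
      · simpa [h] using hf.contDiff.continuous.continuousOn
      · simp only [h, if_false]; exact continuousOn_const)
    (fun x _ j => by
      by_cases h : j = i
      · simpa [h] using hd x
      · simp only [h, if_false]; exact hasFDerivAt_const (0 : ℂ) x)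
    (by
      refine Continuous.integrableOn_Icc ?_
      refine continuous_finsetSum _ fun j _ => ?_
      by_cases h : j = i
      · simpa only [h, if_true] using! (contDiff_partialDeriv hf.contDiff i).continuous
      · simpa [h] using continuous_const)
  rw [setIntegral_congr_set hae]
  have e1 : ∀ x, (∑ j : Fin 3, (if j = i then fderiv ℝ f x else 0) (Pi.single j 1))
      = partialDeriv i f x := by
    intro x
    rw [Finset.sum_eq_single i]
    · simp [partialDeriv]
    · intro j _ hj; simp [hj]
    · simp
  simp only [e1] at key
  rw [key]
  refine Finset.sum_eq_zero fun j _ => ?_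
  by_cases h : j = i
  · subst h
    simp only [if_true]
    have face : ∀ y : Fin 2 → ℝ, f (j.insertNth ((![L, L, a] : Pt) j) y)
        = f (j.insertNth ((0 : Pt) j) y) := by
      intro y
      fin_cases j
      · rw [← hf.periodic_x (Fin.insertNth _ ((0 : Pt) _) y)]
        congr 1; ext k; fin_cases k <;> simp [Fin.insertNth] <;> rfl
      · rw [← hf.periodic_y (Fin.insertNth _ ((0 : Pt) _) y)]
        congr 1; ext k; fin_cases k <;> simp [Fin.insertNth] <;> rfl
      · rw [h0 _ (Or.inr ?_), h0 _ (Or.inl ?_)]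
        · simpa [Fin.insertNth] using hδ
        · simpa [Fin.insertNth] using hδ
    simp only [face, sub_self]
  · simp [h]

theorem isSmoothPeriodic_coord {L : ℝ} {Φ : Pt → Vec} (hΦ : IsSmoothPeriodic L Φ) (j : Fin 3) :
    IsSmoothPeriodic L (fun x => Φ x j) :=
  ⟨contDiff_coord hΦ.contDiff j, fun x => by simp only [hΦ.periodic_x],
    fun x => by simp only [hΦ.periodic_y]⟩

theorem vanishesNearPlates_coord {a : ℝ} {Φ : Pt → Vec} (hΦ : VanishesNearPlates a Φ) (j : Fin 3) :
    VanishesNearPlates a (fun x => Φ x j) := by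
  obtain ⟨δ, hδ, h⟩ := hΦ
  exact ⟨δ, hδ, fun x hx => by simp [h x hx]⟩

theorem integrableOn_slab {L a : ℝ} {f : Pt → ℂ} (hf : Continuous f) :
    IntegrableOn f (slab L a) :=
  (hf.integrableOn_Icc (a := (0 : Pt)) (b := ![L, L, a])).mono_set fun x hx =>
    ⟨fun i => (hx i (mem_univ i)).1.le, fun i => (hx i (mem_univ i)).2.le⟩

theorem exists_periodic_extension {L a : ℝ} (hL : 0 < L) {g : Pt → ℝ} (hg : ContDiff ℝ ∞ g)
    (hc : HasCompactSupport g) (hs : tsupport g ⊆ slab L a) :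
    ∃ G : Pt → ℝ, IsSmoothPeriodic L G ∧ VanishesNearPlates a G ∧ ∀ x ∈ slab L a, G x = g x := by
  have hmem : ∀ x, g x ≠ 0 → x ∈ slab L a := fun x hx => hs (subset_tsupport g hx)
  let v : ℤ × ℤ → Pt := fun n => Pi.single 0 (n.1 * L) + Pi.single 1 (n.2 * L)
  have v0 : ∀ n, v n 0 = n.1 * L := fun n => by simp [v]
  have v1 : ∀ n, v n 1 = n.2 * L := fun n => by simp [v]
  have v2 : ∀ n, v n 2 = 0 := fun n => by simp [v]
  have hfin : LocallyFinite fun n => Function.support fun x => g (x + v n) := by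
    intro x
    refine ⟨Metric.ball x 1, Metric.ball_mem_nhds x one_pos, ?_⟩
    refine (((Set.finite_Icc ⌊(-x 0 - 1) / L⌋ ⌈(L - x 0 + 1) / L⌉).prod
      (Set.finite_Icc ⌊(-x 1 - 1) / L⌋ ⌈(L - x 1 + 1) / L⌉))).subset ?_
    rintro n ⟨y, hy, hyx⟩
    have hd : ∀ i, |y i - x i| < 1 := fun i =>
      lt_of_le_of_lt (dist_le_pi_dist y x i) (Metric.mem_ball.1 hyx)
    have h0 := hmem _ hy 0 (mem_univ _)
    have h1 := hmem _ hy 1 (mem_univ _)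
    simp only [Pi.add_apply, v0, v1, mem_Ioo, Matrix.cons_val_zero, Matrix.cons_val_one] at h0 h1
    have d0 := abs_lt.1 (hd 0)
    have d1 := abs_lt.1 (hd 1)
    refine ⟨⟨?_, ?_⟩, ⟨?_, ?_⟩⟩
    · refine Int.cast_le (R := ℝ).1 ((Int.floor_le _).trans ?_)
      rw [div_le_iff₀ hL]; linarith
    · refine Int.cast_le (R := ℝ).1 (le_trans ?_ (Int.le_ceil _))
      rw [le_div_iff₀ hL]; linarith
    · refine Int.cast_le (R := ℝ).1 ((Int.floor_le _).trans ?_)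
      rw [div_le_iff₀ hL]; linarith
    · refine Int.cast_le (R := ℝ).1 (le_trans ?_ (Int.le_ceil _))
      rw [le_div_iff₀ hL]; linarith
  refine ⟨fun x => ∑ᶠ n, g (x + v n), ⟨?_, fun x => ?_, fun x => ?_⟩, ?_, fun x hx => ?_⟩
  · have := contMDiff_finsum (I' := modelWithCornersSelf ℝ Pt) (I := modelWithCornersSelf ℝ ℝ)
      (n := ∞) (f := fun n x => g (x + v n))
      (fun n => (hg.comp (contDiff_id.add contDiff_const)).contMDiff) hfin
    exact this.contDiff
  · refine Eq.trans ?_ (finsum_comp_equiv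
      ((Equiv.addRight (1 : ℤ)).prodCongr (Equiv.refl ℤ)) (f := fun n => g (x + v n)))
    refine finsum_congr fun n => congrArg g ?_
    ext k; fin_cases k <;> simp [v] <;> ring
  · refine Eq.trans ?_ (finsum_comp_equiv
      ((Equiv.refl ℤ).prodCongr (Equiv.addRight (1 : ℤ))) (f := fun n => g (x + v n)))
    refine finsum_congr fun n => congrArg g ?_
    ext k; fin_cases k <;> simp [v] <;> ring
  · have hopen : IsOpen (slab L a) := isOpen_set_pi finite_univ fun _ _ => isOpen_Ioo
    obtain ⟨δ, hδ, hK⟩ := IsCompact.exists_cthickening_subset_open hc hopen hs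
    refine ⟨δ, hδ, fun x hx => ?_⟩
    refine (finsum_congr fun n => ?_).trans finsum_zero
    by_contra hne
    have hmemK : ∀ s : ℝ, |s| ≤ δ → 0 < x 2 + s ∧ x 2 + s < a := by
      intro s hs'
      have := hK (Metric.mem_cthickening_of_dist_le (x + v n + Pi.single 2 s) (x + v n) δ _
        (subset_tsupport g hne) ?_) 2 (mem_univ _)
      · simpa [v2] using this
      · rw [dist_eq_norm, add_sub_cancel_left, Pi.norm_single]; exact hs'
    rcases hx with hx | hx
    · have := (hmemK (-δ) (by rw [abs_neg, abs_of_pos hδ])).1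
      linarith
    · have := (hmemK δ (by rw [abs_of_pos hδ])).2
      linarith
  · refine (finsum_eq_single _ (0, 0) fun n hn => ?_).trans (by congr 1; ext k; simp [v])
    by_contra hne
    apply hn
    have h0 := hmem _ hne 0 (mem_univ _)
    have h1 := hmem _ hne 1 (mem_univ _)
    have k0 := hx 0 (mem_univ _)
    have k1 := hx 1 (mem_univ _)
    simp only [Pi.add_apply, v0, v1, mem_Ioo, Matrix.cons_val_zero, Matrix.cons_val_one]
      at h0 h1 k0 k1
    have aux : ∀ (m : ℤ) (t : ℝ), 0 < t → t < L → 0 < t + m * L → t + m * L < L → m = 0 := by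
      intro m t h1 h2 h3 h4
      have a1 : (m : ℝ) < 1 := by by_contra! h; nlinarith
      have a2 : (-1 : ℝ) < m := by by_contra! h; nlinarith
      have a1' : m < 1 := by exact_mod_cast a1
      have a2' : -1 < m := by exact_mod_cast a2
      omega
    exact Prod.ext (aux _ _ k0.1 k0.2 h0.1 h0.2) (aux _ _ k1.1 k1.2 h1.1 h1.2)

/-- The weak curl is unique, so the Maxwell form is a function of the fields alone. -/
theorem HasWeakCurl.unique {L a : ℝ} (hL : 0 < L) {E C C' : L2Field L a}
    (h : HasWeakCurl L a E C) (h' : HasWeakCurl L a E C') : C = C' := by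
  have hopen : IsOpen (slab L a) := isOpen_set_pi finite_univ fun _ _ => isOpen_Ioo
  have hD : ∀ j : Fin 3, ∀ᵐ x ∂(volume.restrict (slab L a)), (C - C') x j = 0 := by
    intro j
    have hint : Integrable (fun x => (C - C') x j) (volume.restrict (slab L a)) :=
      (EuclideanSpace.proj (𝕜 := ℂ) j).integrable_comp
        ((Lp.memLp (C - C')).integrable one_le_two)
    have key := hopen.ae_eq_zero_of_integral_contDiff_smul_eq_zero
      (μ := volume.restrict (slab L a)) (f := fun x => (C - C') x j)
      (hint.locallyIntegrable.locallyIntegrableOn _) ?_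
    · filter_upwards [key, ae_restrict_mem hopen.measurableSet] with x h1 h2 using h1 h2
    · intro g hg hc hs
      obtain ⟨G, hG, hG0, hGg⟩ := exists_periodic_extension hL hg hc hs
      have hΦ : IsSmoothPeriodic L (fun x => (EuclideanSpace.single j (G x : ℂ) : Vec)) := by
        refine ⟨?_, fun x => by simp only [hG.periodic_x], fun x => by simp only [hG.periodic_y]⟩
        have : (fun x => (EuclideanSpace.single j (G x : ℂ) : Vec))
            = fun x => G x • (EuclideanSpace.single j (1 : ℂ) : Vec) := by
          ext x i
          by_cases hij : i = j <;> simp [hij]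
        rw [this]
        exact hG.contDiff.smul contDiff_const
      have hΦ0 : VanishesNearPlates a (fun x => (EuclideanSpace.single j (G x : ℂ) : Vec)) := by
        obtain ⟨δ, hδ, hz⟩ := hG0
        exact ⟨δ, hδ, fun x hx => by simp [hz x hx]⟩
      have e := (h _ hΦ hΦ0).symm.trans (h' _ hΦ hΦ0)
      rw [integral_inner_eq L a hΦ.contDiff.continuous, integral_inner_eq L a
        hΦ.contDiff.continuous, ← sub_eq_zero, ← inner_sub_right,
        ← integral_inner_eq L a hΦ.contDiff.continuous] at e
      rw [← e]
      refine setIntegral_congr_fun hopen.measurableSet fun x hx => ?_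
      simp [EuclideanSpace.inner_single_left, hGg x hx]
  rw [← sub_eq_zero]
  refine Lp.eq_zero_iff_ae_eq_zero.2 ?_
  filter_upwards [hD 0, hD 1, hD 2] with x h0 h1 h2
  ext i
  fin_cases i
  · exact h0
  · exact h1
  · exact h2

/-- The form domain of divergence-free perfect-conductor fields. -/
def VPEC (L a : ℝ) : Submodule ℂ (L2Field L a) :=
  (pecGraph L a).map (WithLp.fstₗ 2 ℂ (L2Field L a) (L2Field L a))

/-- The closure of the form domain in `L²`. -/
def HPEC (L a : ℝ) : Submodule ℂ (L2Field L a) := (VPEC L a).topologicalClosure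

/-- The normalized static normal mode `(L² a)^(-1/2) e_z`. -/
def staticMode (L a : ℝ) : L2Field L a :=
  Lp.const 2 (volume.restrict (slab L a)) !₂[0, 0, (((√(L ^ 2 * a))⁻¹ : ℝ) : ℂ)]

/-- The reduced physical Hilbert space: the orthogonal complement of the static mode in `HPEC`. -/
def Hphys (L a : ℝ) : Submodule ℂ (L2Field L a) := HPEC L a ⊓ (ℂ ∙ staticMode L a)ᗮ

theorem isClosed_Hphys (L a : ℝ) : IsClosed (Hphys L a : Set (L2Field L a)) :=
  (Submodule.isClosed_topologicalClosure _).inter (Submodule.isClosed_orthogonal _)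

instance completeSpace_Hphys (L a : ℝ) : CompleteSpace (Hphys L a) :=
  (isClosed_Hphys L a).completeSpace_coe

/-- The graph of the curl over the reduced form domain `VPEC ∩ Hphys`: the pairs `(E, ∇ × E)` with
`E` in `VPEC ∩ Hphys`, with the `H(curl)` graph norm. -/
def physGraph (L a : ℝ) : Submodule ℂ (WithLp 2 (L2Field L a × L2Field L a)) :=
  pecGraph L a ⊓ (Hphys L a).comap (WithLp.fstₗ 2 ℂ (L2Field L a) (L2Field L a))

theorem isClosed_physGraph (L a : ℝ) :
    IsClosed (physGraph L a : Set (WithLp 2 (L2Field L a × L2Field L a))) :=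
  (isClosed_pecGraph L a).inter ((isClosed_Hphys L a).preimage
    (WithLp.fstL 2 ℂ (L2Field L a) (L2Field L a)).continuous)

instance completeSpace_physGraph (L a : ℝ) : CompleteSpace (physGraph L a) :=
  (isClosed_physGraph L a).completeSpace_coe

theorem staticMode_coeFn (L a : ℝ) : staticMode L a =ᵐ[volume.restrict (slab L a)]
    fun _ => !₂[0, 0, (((√(L ^ 2 * a))⁻¹ : ℝ) : ℂ)] :=
  Lp.coeFn_const _ _ _

theorem staticMode_mem_pecGraph {L a : ℝ} (hL : 0 < L) (ha : 0 < a) :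
    WithLp.toLp 2 (staticMode L a, 0) ∈ pecGraph L a := by
  set c : ℂ := (((√(L ^ 2 * a))⁻¹ : ℝ) : ℂ) with hc
  have hin : ∀ u : Vec, ⟪u, (!₂[0, 0, c] : Vec)⟫_ℂ = c * (starRingEnd ℂ) (u 2) := by
    intro u
    simp [PiLp.inner_apply, Fin.sum_univ_three]
  refine ⟨fun Φ hΦ h0 => ?_, ?_, fun φ hφ h0 => ?_⟩
  · change ∫ x in slab L a, ⟪curl Φ x, staticMode L a x⟫_ℂ
      = ∫ x in slab L a, ⟪Φ x, (0 : L2Field L a) x⟫_ℂ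
    have e1 : ∫ x in slab L a, ⟪curl Φ x, staticMode L a x⟫_ℂ
        = ∫ x in slab L a, c * (starRingEnd ℂ) (curl Φ x 2) := by
      refine integral_congr_ae ?_
      filter_upwards [staticMode_coeFn L a] with x hx
      rw [hx, hin]
    rw [e1, integral_inner_eq L a hΦ.contDiff.continuous, inner_zero_right, integral_const_mul,
      integral_conj]
    have e2 : ∫ x in slab L a, curl Φ x 2 = 0 := by
      have hx := fun i j => integrableOn_slab (L := L) (a := a)
        (contDiff_partialDeriv (contDiff_coord hΦ.contDiff j) i).continuous
      change ∫ x in slab L a, (partialDeriv 0 (fun y => Φ y 1) x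
        - partialDeriv 1 (fun y => Φ y 0) x) = 0
      rw [integral_sub (hx 0 1) (hx 1 0),
        integral_partialDeriv_eq_zero hL ha (isSmoothPeriodic_coord hΦ 1)
          (vanishesNearPlates_coord h0 1),
        integral_partialDeriv_eq_zero hL ha (isSmoothPeriodic_coord hΦ 0)
          (vanishesNearPlates_coord h0 0), sub_zero]
    rw [e2]; simp
  · refine Submodule.le_topologicalClosure _ ⟨fun _ => !₂[0, 0, c],
      ⟨contDiff_const, fun _ => rfl, fun _ => rfl⟩, fun _ _ => ⟨rfl, rfl⟩,
      staticMode_coeFn L a, ?_⟩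
    have h0 : curl (fun _ => (!₂[0, 0, c] : Vec)) = 0 := by
      ext x i
      fin_cases i <;> simp [curl, partialDeriv]
    rw [h0]
    exact Lp.coeFn_zero _ _ _
  · change ∫ x in slab L a, ⟪grad φ x, staticMode L a x⟫_ℂ = 0
    have e1 : ∫ x in slab L a, ⟪grad φ x, staticMode L a x⟫_ℂ
        = ∫ x in slab L a, c * (starRingEnd ℂ) (partialDeriv 2 φ x) := by
      refine integral_congr_ae ?_
      filter_upwards [staticMode_coeFn L a] with x hx
      rw [hx, hin]; rfl
    rw [e1, integral_const_mul, integral_conj, integral_partialDeriv_eq_zero hL ha hφ h0]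
    simp

theorem eq_zero_of_orthogonal_physGraph {L a : ℝ} (hL : 0 < L) (ha : 0 < a) {G : L2Field L a}
    (hG : G ∈ Hphys L a) (h : ∀ q ∈ physGraph L a, ⟪q.fst, G⟫_ℂ = 0) : G = 0 := by
  have hs := staticMode_mem_pecGraph hL ha
  have hsG : ⟪staticMode L a, G⟫_ℂ = 0 :=
    hG.2 _ (Submodule.mem_span_singleton_self _)
  have hV : G ∈ (VPEC L a)ᗮ := by
    rintro F ⟨p, hp, rfl⟩
    obtain ⟨c, hc⟩ := Submodule.mem_span_singleton.1
      ((ℂ ∙ staticMode L a).orthogonalProjectionOnto p.fst).2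
    have hr : p - c • WithLp.toLp 2 (staticMode L a, (0 : L2Field L a)) ∈ pecGraph L a :=
      Submodule.sub_mem _ hp (Submodule.smul_mem _ c hs)
    have hq : p - c • WithLp.toLp 2 (staticMode L a, (0 : L2Field L a)) ∈ physGraph L a := by
      refine ⟨hr, Submodule.le_topologicalClosure _ ⟨_, hr, rfl⟩, ?_⟩
      change p.fst - c • staticMode L a ∈ (ℂ ∙ staticMode L a)ᗮ
      rw [hc]
      exact Submodule.sub_starProjection_mem_orthogonal _
    have := h _ hq
    change ⟪p.fst - c • staticMode L a, G⟫_ℂ = 0 at this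
    rw [inner_sub_left, inner_smul_left, hsG, mul_zero, sub_zero] at this
    exact this
  have hG' : G ∈ (HPEC L a)ᗮ := by
    rw [HPEC, Submodule.orthogonal_closure]; exact hV
  exact inner_self_eq_zero.1 (hG' G hG.1)

/-- The pairs `(E, G)` with `E` in the reduced form domain, `G` in `Hphys`, and
`∫ (∇ × E) · conj (∇ × F) = ∫ G · conj F` for every `F` in the reduced form domain. -/
def maxwellGraph (L a : ℝ) : Submodule ℂ (Hphys L a × Hphys L a) where
  carrier := {p | ∃ e ∈ physGraph L a, e.fst = (p.1 : L2Field L a) ∧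
    ∀ q ∈ physGraph L a, ⟪q.snd, e.snd⟫_ℂ = ⟪q.fst, (p.2 : L2Field L a)⟫_ℂ}
  zero_mem' := by
    refine ⟨0, Submodule.zero_mem _, rfl, fun q _ => ?_⟩
    rw [WithLp.zero_snd, Prod.snd_zero, Submodule.coe_zero, inner_zero_right, inner_zero_right]
  add_mem' := by
    rintro p p' ⟨e, he, h1, h⟩ ⟨e', he', h1', h'⟩
    refine ⟨e + e', Submodule.add_mem _ he he', ?_, fun q hq => ?_⟩
    · rw [WithLp.add_fst, h1, h1', Prod.fst_add, Submodule.coe_add]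
    · rw [WithLp.add_snd, Prod.snd_add, Submodule.coe_add, inner_add_right, inner_add_right,
        h q hq, h' q hq]
  smul_mem' := by
    rintro c p ⟨e, he, h1, h⟩
    refine ⟨c • e, Submodule.smul_mem _ c he, ?_, fun q hq => ?_⟩
    · rw [WithLp.smul_fst, h1, Prod.smul_fst, Submodule.coe_smul]
    · rw [WithLp.smul_snd, Prod.smul_snd, Submodule.coe_smul, inner_smul_right, inner_smul_right,
        h q hq]

/-- The field `G` is determined by `E`. -/
theorem maxwellGraph_functional {L a : ℝ} (hL : 0 < L) (ha : 0 < a)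
    (x : Hphys L a × Hphys L a) (hx : x ∈ maxwellGraph L a) (hx0 : x.1 = 0) : x.2 = 0 := by
  obtain ⟨e, he, he1, h⟩ := hx
  have h1 : e.fst = 0 := by rw [he1, hx0]; rfl
  have h2 : e.snd = 0 := by
    have := h e he
    rw [h1, inner_zero_left] at this
    exact inner_self_eq_zero.1 this
  refine Subtype.ext (eq_zero_of_orthogonal_physGraph hL ha x.2.2 fun q hq => ?_)
  rw [← h q hq, h2, inner_zero_right]

/-- The reduced perfect-conductor Maxwell operator: the operator on `Hphys` associated with the
closed form `q[E, F] = ∫ (∇ × E) · conj (∇ × F)` on the reduced form domain. -/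
def maxwellOperator (L a : ℝ) : Hphys L a →ₗ.[ℂ] Hphys L a := (maxwellGraph L a).toLinearPMap

theorem maxwellOperator_graph {L a : ℝ} (hL : 0 < L) (ha : 0 < a) :
    (maxwellOperator L a).graph = maxwellGraph L a :=
  Submodule.toLinearPMap_graph_eq _ (maxwellGraph_functional hL ha)

/-- The embedding of the reduced form domain, with its graph norm, into `Hphys`. -/
def physEmbedding (L a : ℝ) : physGraph L a →L[ℂ] Hphys L a :=
  ((WithLp.fstL 2 ℂ (L2Field L a) (L2Field L a)).comp (physGraph L a).subtypeL).codRestrict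
    (Hphys L a) fun q => q.2.2

theorem mem_maxwellGraph_iff (L a : ℝ) (x y : Hphys L a) :
    (x, y) ∈ maxwellGraph L a ↔
      physEmbedding L a ((physEmbedding L a).adjoint (x + y)) = x := by
  have hJ : ∀ q : physGraph L a, ((physEmbedding L a q : Hphys L a) : L2Field L a) = q.1.fst :=
    fun q => rfl
  constructor
  · rintro ⟨e, he, h1, h⟩
    have : (physEmbedding L a).adjoint (x + y) = ⟨e, he⟩ := by
      refine ext_inner_left ℂ fun q => ?_
      rw [ContinuousLinearMap.adjoint_inner_right, Submodule.coe_inner, Submodule.coe_inner,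
        WithLp.prod_inner_apply, Submodule.coe_add, inner_add_right, hJ]
      exact congrArg₂ (· + ·) (by rw [← h1]; rfl) (h q.1 q.2).symm
    rw [this]
    exact Subtype.ext h1
  · intro hx
    set e := (physEmbedding L a).adjoint (x + y) with he
    refine ⟨e.1, e.2, congrArg Subtype.val hx, fun q hq => ?_⟩
    have h := ContinuousLinearMap.adjoint_inner_right (physEmbedding L a) ⟨q, hq⟩ (x + y)
    rw [← he, Submodule.coe_inner, Submodule.coe_inner, WithLp.prod_inner_apply,
      Submodule.coe_add, inner_add_right, hJ] at h
    have h2 : ⟪q.fst, e.1.fst⟫_ℂ = ⟪q.fst, (x : L2Field L a)⟫_ℂ := by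
      rw [← hx]; rfl
    change ⟪q.fst, e.1.fst⟫_ℂ + ⟪q.snd, e.1.snd⟫_ℂ = _ at h
    rw [h2] at h
    exact add_left_cancel h

section FunctionalCalculus

variable {H : Type*} [NormedAddCommGroup H] [InnerProductSpace ℂ H] [CompleteSpace H]

/-- The bounded operator `R` is the two-sided inverse `(A - z)⁻¹` of the operator `A - z`. -/
def IsResolvent (A : H →ₗ.[ℂ] H) (z : ℂ) (R : H →L[ℂ] H) : Prop :=
  (∀ w : H, ∃ x : A.domain, (x : H) = R w ∧ A x - z • (x : H) = w) ∧
    ∀ x : A.domain, R (A x - z • (x : H)) = x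

open Classical in
/-- The resolvent `(A - z)⁻¹`; it is unique when it exists. -/
def resolventAt (A : H →ₗ.[ℂ] H) (z : ℂ) : H →L[ℂ] H :=
  if h : ∃ R : H →L[ℂ] H, IsResolvent A z R then h.choose else 0

/-- The operator `f(A)`, for a nonnegative self-adjoint operator `A` and a function `f` that is
continuous on `[0, ∞)` and vanishes at infinity: the image of `R = (A + 1)⁻¹`, whose spectrum lies
in `[0, 1]`, under the continuous functional calculus, for the function `t ↦ f (1 / t - 1)` extended
by `0` to `t = 0` (so that `λ = 1 / t - 1` corresponds to `t = 1 / (λ + 1)`). -/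
def functionOf (A : H →ₗ.[ℂ] H) (f : ℝ → ℝ) : H →L[ℂ] H :=
  cfc (fun t : ℝ => if t = 0 then 0 else f (t⁻¹ - 1)) (resolventAt A (-1))

/-- The trace `∑ i, ⟪b i, T (b i)⟫` of a positive operator `T`, as an element of `[0, ∞]`, computed in
the orthonormal basis `b`. -/
def traceIn {ι : Type*} (b : HilbertBasis ι ℂ H) (T : H →L[ℂ] H) : ℝ≥0∞ :=
  ∑' i, ENNReal.ofReal (⟪b i, T (b i)⟫_ℂ).re

end FunctionalCalculus

/-- The Maxwell operator has a bounded resolvent at `-1`. -/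
theorem isResolvent_maxwellOperator {L a : ℝ} (hL : 0 < L) (ha : 0 < a) :
    IsResolvent (maxwellOperator L a) (-1)
      ((physEmbedding L a).comp (physEmbedding L a).adjoint) := by
  have hg : ∀ x y, (∃ z : (maxwellOperator L a).domain, (z : Hphys L a) = x ∧
      maxwellOperator L a z = y) ↔
        physEmbedding L a ((physEmbedding L a).adjoint (x + y)) = x := by
    intro x y
    rw [← mem_maxwellGraph_iff, ← maxwellOperator_graph hL ha, LinearPMap.mem_graph_iff]
  constructor
  · intro w
    set u := physEmbedding L a ((physEmbedding L a).adjoint w) with hu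
    obtain ⟨z, hz1, hz2⟩ := (hg u (w - u)).2 (by rw [add_sub_cancel])
    refine ⟨z, hz1, ?_⟩
    rw [hz2, hz1]; module
  · intro z
    have := (hg z (maxwellOperator L a z)).1 ⟨z, rfl, rfl⟩
    rw [neg_one_smul, sub_neg_eq_add, add_comm]
    exact this

theorem IsResolvent.unique {H : Type*} [NormedAddCommGroup H] [InnerProductSpace ℂ H]
    {A : H →ₗ.[ℂ] H} {z : ℂ} {R R' : H →L[ℂ] H} (h : IsResolvent A z R)
    (h' : IsResolvent A z R') : R = R' := by
  ext w
  obtain ⟨x, hx, hw⟩ := h.1 w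
  rw [← hx, ← h'.2 x, hw]

theorem resolventAt_maxwellOperator {L a : ℝ} (hL : 0 < L) (ha : 0 < a) :
    resolventAt (maxwellOperator L a) (-1)
      = (physEmbedding L a).comp (physEmbedding L a).adjoint := by
  have h : ∃ R, IsResolvent (maxwellOperator L a) (-1) R := ⟨_, isResolvent_maxwellOperator hL ha⟩
  rw [resolventAt, dif_pos h]
  exact h.choose_spec.unique (isResolvent_maxwellOperator hL ha)

/-- The operator `A ^ p exp (-τ A)` for the reduced Maxwell operator `A`. -/
def heatPower (L a p τ : ℝ) : Hphys L a →L[ℂ] Hphys L a :=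
  functionOf (maxwellOperator L a) fun l => l ^ p * Real.exp (-(τ * l))

/-- The number `|k_m|²`, where `k_m = (2 π / L) m`. -/
def kSq (L : ℝ) (m : ℤ × ℤ) : ℝ := (2 * Real.pi / L * m.1) ^ 2 + (2 * Real.pi / L * m.2) ^ 2

/-- The number `ν_n = π n / a`. -/
def nu (a : ℝ) (n : ℕ) : ℝ := Real.pi * n / a

end

end MaxwellSlab

/-! The trace becomes a sum over an explicit orthonormal eigenbasis. The resolvent at `-1` is `J
J*`, where `J` is the contraction embedding the form domain, with its graph norm, into `Hphys`; its
spectrum therefore lies in `[0, 1]`. A field satisfying the form eigenvalue equation with eigenvalue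
`λ` is an eigenvector of the resolvent with eigenvalue `1 / (λ + 1)`, and the continuous functional
calculus sends it to `f(λ)` times itself (`cfc_apply_of_apply_eq_smul`). For a self-adjoint operator
that is diagonal in some orthonormal basis with nonnegative eigenvalues, Tonelli's theorem gives the
same trace in every basis (`traceIn_eq_tsum_eigenvalues`).

The eigenfields are `(u₀ s, u₁ s, u₂ c)` with `s = exp(i k_m·(x,y)) sin(ν_n z)` and `c` the same
with a cosine. The sine makes the tangential components vanish on the plates, and the divergence
vanishes when `u` is orthogonal to the direction of `∇s`. On such fields curl curl is multiplication
by `|k_m|² + ν_n²`. Integration by parts against smooth fields with the plate condition, and closure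
in the graph norm, turn this into the form identity (`inner_magneticField_curl`). For `n ≥ 1` the
admissible `u` form a plane, whence the factor 2. For `n = 0` the sine vanishes and only the normal
polarization survives; its mode with `m = 0` is the static mode, which `Hphys` excludes.

Completeness is the main work (`exists_maxwell_eigenbasis`). A field of `Hphys` orthogonal to all
these modes is also orthogonal to the gradient polarizations, being divergence free
(`inner_electricField_gradDirection_eq_zero`, by cutting off near the plates). It is thus orthogonal
to the modes with every polarization, so its components are orthogonal to all scalar sine or cosine
modes. These are complete: the cosine modes span a star algebra that separates points, and the sine
case reduces to the cosine case. Finiteness follows by absorbing `λ^p` into half of the exponential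
and factoring the remaining Gaussian sum. -/

namespace MaxwellSlab

noncomputable section

/-! ### Functional calculus and trace on an eigenbasis -/

section EigenbasisTrace

variable {H : Type*} [NormedAddCommGroup H] [InnerProductSpace ℂ H]

theorem mem_spectrum_of_apply_eq_smul {T : H →L[ℂ] H} {v : H} {μ : ℝ} (hv : v ≠ 0)
    (h : T v = μ • v) : μ ∈ spectrum ℝ T := by
  rw [spectrum.mem_iff]
  intro hu
  obtain ⟨S, hS⟩ := hu.exists_left_inv
  have h1 := congrArg (fun A : H →L[ℂ] H => A v) hS
  have h2 : (algebraMap ℝ (H →L[ℂ] H) μ - T) v = 0 := by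
    rw [Algebra.algebraMap_eq_smul_one]
    simp [h]
  simp only [mul_apply_eq_comp, h2, map_zero, one_apply_eq_self] at h1
  exact hv h1.symm

/-- The continuous functional calculus acts on eigenvectors through the eigenvalue. -/
theorem cfc_apply_of_apply_eq_smul [CompleteSpace H] {T : H →L[ℂ] H} (hT : IsSelfAdjoint T) {v : H} {μ : ℝ}
    (h : T v = μ • v) {f : ℝ → ℝ} (hf : ContinuousOn f (spectrum ℝ T)) :
    cfc f T v = f μ • v := by
  rcases eq_or_ne v 0 with rfl | hv
  · simp
  have hμ := mem_spectrum_of_apply_eq_smul hv h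
  rw [cfc_apply f T hT hf]
  -- Both sides are multiplicative and continuous in `g`, so constants and the identity suffice, by
  -- Stone–Weierstrass on the compact spectrum.
  have key : ∀ g : C(spectrum ℝ T, ℝ), cfcHom (R := ℝ) hT g v = g ⟨μ, hμ⟩ • v := by
    intro g
    induction g using ContinuousMap.induction_on_of_compact with
    | const r =>
      have : ContinuousMap.const (spectrum ℝ T) r = algebraMap ℝ C(spectrum ℝ T, ℝ) r := rfl
      rw [this, AlgHomClass.commutes, Algebra.algebraMap_eq_smul_one]
      simp
    | id => rw [cfcHom_id hT, h]; rfl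
    | star_id =>
      rw [star_trivial, cfcHom_id hT, h]; rfl
    | add f g hf hg => rw [map_add, add_apply, hf, hg, ContinuousMap.add_apply,
        add_smul]
    | mul f g hf hg =>
      rw [map_mul, mul_apply_eq_comp, hg, ContinuousMap.mul_apply]
      have : (cfcHom (R := ℝ) hT f) (g ⟨μ, hμ⟩ • v) = g ⟨μ, hμ⟩ • (cfcHom (R := ℝ) hT f) v := by
        rw [← Complex.coe_smul, map_smul, Complex.coe_smul]
      rw [this, hf, smul_smul, mul_comm]
    | frequently f hf =>
      have hcl : IsClosed {g : C(spectrum ℝ T, ℝ) | cfcHom (R := ℝ) hT g v = g ⟨μ, hμ⟩ • v} :=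
        isClosed_eq
          ((ContinuousLinearMap.apply ℂ H v).continuous.comp (cfcHom_continuous hT))
          ((continuous_eval_const (⟨μ, hμ⟩ : spectrum ℝ T)).fun_smul continuous_const)
      exact hcl.mem_of_frequently_of_tendsto hf Filter.tendsto_id
  exact key _

/-- The trace of a symmetric operator with nonnegative eigenvalues is the sum of its eigenvalues,
whatever the basis in which it is computed. -/
theorem traceIn_eq_tsum_eigenvalues [CompleteSpace H] {ι κ : Type*} (b : HilbertBasis ι ℂ H)
    (v : HilbertBasis κ ℂ H) {T : H →L[ℂ] H} (hT : IsSelfAdjoint T) {μ : κ → ℝ}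
    (hμ : ∀ k, 0 ≤ μ k) (h : ∀ k, T (v k) = μ k • v k) :
    traceIn b T = ∑' k, ENNReal.ofReal (μ k) := by
  have hsum' : ∀ x : H, HasSum (fun i => ‖⟪b i, x⟫_ℂ‖ ^ 2) (‖x‖ ^ 2) := by
    intro x
    have h1 := (b.hasSum_inner_mul_inner x x).mapL Complex.reCLM
    convert! h1 using 1
    · funext i
      rw [← inner_conj_symm x, Complex.conj_mul', Complex.reCLM_apply]
      norm_cast
    · rw [inner_self_eq_norm_sq_to_K, Complex.reCLM_apply]
      norm_cast
  -- The action of `T` is known only on the `v k`; self-adjointness moves it there, giving `⟪v k, T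
  -- x⟫ = μ k * ⟪v k, x⟫`.
  have hquad : ∀ x : H, HasSum (fun k => μ k * ‖⟪v k, x⟫_ℂ‖ ^ 2) (⟪x, T x⟫_ℂ).re := by
    intro x
    have h1 := (v.hasSum_inner_mul_inner x (T x)).mapL Complex.reCLM
    convert! h1 using 1
    funext k
    have h2 : ⟪v k, T x⟫_ℂ = μ k * ⟪v k, x⟫_ℂ := by
      rw [← ContinuousLinearMap.adjoint_inner_left, hT.adjoint_eq, h k, ← Complex.coe_smul,
        inner_smul_left, Complex.conj_ofReal]
    rw [h2, mul_left_comm, ← inner_conj_symm x, Complex.conj_mul', Complex.reCLM_apply]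
    norm_cast
  have e1 : ∀ i, ENNReal.ofReal (⟪b i, T (b i)⟫_ℂ).re
      = ∑' k, ENNReal.ofReal (μ k * ‖⟪v k, b i⟫_ℂ‖ ^ 2) := by
    intro i
    rw [← (hquad (b i)).tsum_eq,
      ENNReal.ofReal_tsum_of_nonneg (fun k => mul_nonneg (hμ k) (sq_nonneg _)) (hquad _).summable]
  unfold traceIn
  simp only [e1]
  -- All terms are nonnegative, so Tonelli applies without a summability hypothesis; the sum over
  -- `i` is then Parseval for the unit vector `v k`.
  rw [ENNReal.tsum_comm]
  refine tsum_congr fun k => ?_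
  simp only [ENNReal.ofReal_mul (hμ k)]
  rw [ENNReal.tsum_mul_left]
  have h2 := hsum' (v k)
  simp only [norm_inner_symm (b _) (v k), v.orthonormal.1 k] at h2
  rw [← ENNReal.ofReal_tsum_of_nonneg (fun k => sq_nonneg _) h2.summable, h2.tsum_eq]
  simp

end EigenbasisTrace

/-! ### The symbol `l ^ p * exp (-τ l)` and convergence of the mode sums -/

/-- The function of the resolvent `(A + 1)⁻¹` that represents `f(A)` is continuous on `[0, 1]`. -/
theorem continuousOn_resolvent_symbol {f : ℝ → ℝ} (hf : ContinuousOn f (Ici 0))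
    (hlim : Filter.Tendsto f Filter.atTop (nhds 0)) :
    ContinuousOn (fun t : ℝ => if t = 0 then 0 else f (t⁻¹ - 1)) (Icc 0 1) := by
  intro t ht
  rcases eq_or_lt_of_le ht.1 with rfl | h0
  -- The point `t = 0` corresponds to `λ = ∞`, where the decay of `f` matches the assigned value
  -- `0`.
  · rw [← continuousWithinAt_sdiff_self, ContinuousWithinAt, if_pos rfl]
    have h1 : Filter.Tendsto (fun t : ℝ => f (t⁻¹ - 1)) (nhdsWithin 0 (Ioi 0)) (nhds 0) :=
      hlim.comp (Filter.tendsto_atTop_add_const_right _ (-1) tendsto_inv_nhdsGT_zero)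
    have hsub : Icc (0 : ℝ) 1 \ {0} ⊆ Ioi 0 := fun s hs => lt_of_le_of_ne hs.1.1 (Ne.symm hs.2)
    refine (h1.mono_left (nhdsWithin_mono _ hsub)).congr' ?_
    filter_upwards [self_mem_nhdsWithin] with s hs
    rw [if_neg (show s ≠ 0 from hs.2)]
  -- Intersecting with `t > 0` makes `t ≤ 1` give `t⁻¹ - 1 ≥ 0`, the half-line on which `f` is
  -- continuous.
  · have : ContinuousWithinAt (fun t : ℝ => f (t⁻¹ - 1)) (Icc 0 1 ∩ Ioi 0) t := by
      have h1 := hf (t⁻¹ - 1) (by have := (one_le_inv₀ h0).2 ht.2; simpa using this)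
      refine ContinuousWithinAt.comp (g := f) (t := Ici 0) h1 ?_ ?_
      · exact ((continuousAt_inv₀ h0.ne').sub continuousAt_const).continuousWithinAt
      · intro s hs
        have := (one_le_inv₀ hs.2).2 hs.1.2
        simpa using this
    have h2 : ContinuousWithinAt (fun t : ℝ => f (t⁻¹ - 1)) (Icc 0 1) t :=
      (continuousWithinAt_inter (Ioi_mem_nhds h0)).1 this
    refine h2.congr_of_eventuallyEq ?_ (by simp [h0.ne'])
    filter_upwards [mem_nhdsWithin_of_mem_nhds (Ioi_mem_nhds h0)] with s hs
    simp [(show (0:ℝ) < s from hs).ne']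

theorem tendsto_heatPower_symbol (p : ℝ) {τ : ℝ} (hτ : 0 < τ) :
    Filter.Tendsto (fun l : ℝ => l ^ p * Real.exp (-(τ * l))) Filter.atTop (nhds 0) := by
  simpa using tendsto_rpow_mul_exp_neg_mul_atTop_nhds_zero p τ hτ

theorem continuous_heatPower_symbol {p : ℝ} (hp : 0 ≤ p) (τ : ℝ) :
    Continuous (fun l : ℝ => l ^ p * Real.exp (-(τ * l))) :=
  (Real.continuous_rpow_const hp).mul (by fun_prop)

/-- Half of the exponential absorbs the power, since `l ^ p * exp (-(τ / 2) l)` is bounded on `[0,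
∞)`. What remains is a pure exponential, which factors over a sum of eigenvalue contributions. -/
theorem exists_heatPower_symbol_le {p τ : ℝ} (hp : 0 ≤ p) (hτ : 0 < τ) :
    ∃ C, 0 ≤ C ∧ ∀ l : ℝ, 0 ≤ l → l ^ p * Real.exp (-(τ * l)) ≤ C * Real.exp (-(τ / 2 * l)) := by
  have hc := continuous_heatPower_symbol hp (τ / 2)
  have ht := tendsto_heatPower_symbol p (half_pos hτ)
  obtain ⟨N, hN⟩ := Filter.eventually_atTop.1 (ht.eventually (gt_mem_nhds one_pos))
  obtain ⟨K, hK⟩ := (isCompact_Icc (a := (0 : ℝ)) (b := N)).exists_bound_of_continuousOn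
    hc.continuousOn
  refine ⟨max K 1, le_max_of_le_right zero_le_one, fun l hl => ?_⟩
  have h1 : l ^ p * Real.exp (-(τ / 2 * l)) ≤ max K 1 := by
    rcases le_total l N with h | h
    · exact (le_abs_self _).trans ((hK l ⟨hl, h⟩).trans (le_max_left _ _))
    · exact (hN l h).le.trans (le_max_right _ _)
  calc l ^ p * Real.exp (-(τ * l))
      = l ^ p * Real.exp (-(τ / 2 * l)) * Real.exp (-(τ / 2 * l)) := by
        rw [mul_assoc, ← Real.exp_add]; ring_nf
    _ ≤ _ := mul_le_mul_of_nonneg_right h1 (Real.exp_pos _).le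

theorem tsum_ofReal_exp_neg_sq_lt_top {c : ℝ} (hc : 0 < c) :
    ∑' n : ℤ, ENNReal.ofReal (Real.exp (-(c * (n : ℝ) ^ 2))) < ⊤ := by
  have h : ∀ g : ℕ → ℝ, (∀ i : ℕ, (i : ℝ) ≤ g i) → Summable fun i => Real.exp (-(c * g i)) := by
    intro g hg
    simpa using Real.summable_exp_nat_mul_of_ge (neg_lt_zero.2 hc) hg
  -- Since `n ≤ n²` on the naturals, a geometric series dominates.
  have hn : Summable fun n : ℕ => Real.exp (-(c * (n : ℝ) ^ 2)) :=
    h _ fun i => by exact_mod_cast Nat.le_self_pow two_ne_zero i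
  have : Summable fun n : ℤ => Real.exp (-(c * (n : ℝ) ^ 2)) :=
    Summable.of_nat_of_neg (by simpa using hn) (by simpa using hn)
  rw [← ENNReal.ofReal_tsum_of_nonneg (fun _ => (Real.exp_pos _).le) this]
  exact ENNReal.ofReal_lt_top

theorem tsum_ofReal_exp_neg_kSq_lt_top {L c : ℝ} (hL : 0 < L) (hc : 0 < c) :
    ∑' m : ℤ × ℤ, ENNReal.ofReal (Real.exp (-(c * kSq L m))) < ⊤ := by
  have hd : 0 < c * (2 * Real.pi / L) ^ 2 := by positivity
  have e : ∀ m : ℤ × ℤ, ENNReal.ofReal (Real.exp (-(c * kSq L m)))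
      = ENNReal.ofReal (Real.exp (-(c * (2 * Real.pi / L) ^ 2 * (m.1 : ℝ) ^ 2))) *
        ENNReal.ofReal (Real.exp (-(c * (2 * Real.pi / L) ^ 2 * (m.2 : ℝ) ^ 2))) := by
    intro m
    rw [← ENNReal.ofReal_mul (Real.exp_pos _).le, ← Real.exp_add, kSq]
    ring_nf
  simp only [e]
  rw [ENNReal.tsum_prod']
  simp only [ENNReal.tsum_mul_left, ENNReal.tsum_mul_right]
  exact ENNReal.mul_lt_top (tsum_ofReal_exp_neg_sq_lt_top hd) (tsum_ofReal_exp_neg_sq_lt_top hd)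

theorem tsum_ofReal_exp_neg_nu_lt_top {a c : ℝ} (ha : 0 < a) (hc : 0 < c) :
    ∑' n : ℕ, ENNReal.ofReal (Real.exp (-(c * nu a (n + 1) ^ 2))) < ⊤ := by
  have hd : 0 < c * (Real.pi / a) ^ 2 := by positivity
  refine lt_of_le_of_lt ?_ (tsum_ofReal_exp_neg_sq_lt_top hd)
  -- The sum over `n ≥ 1` is part of the sum over all integers, through the injection `n ↦ n + 1`.
  refine le_trans (le_of_eq (tsum_congr fun n => ?_)) (ENNReal.tsum_comp_le_tsum_of_injective
    (f := fun n : ℕ => ((n + 1 : ℕ) : ℤ)) (fun i j h => by simpa using h)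
    (fun n : ℤ => ENNReal.ofReal (Real.exp (-(c * (Real.pi / a) ^ 2 * (n : ℝ) ^ 2)))))
  rw [nu]
  push_cast
  ring_nf

theorem kSq_nonneg (L : ℝ) (m : ℤ × ℤ) : 0 ≤ kSq L m := by unfold kSq; positivity

/-- The sum over the transverse modes is finite. -/
theorem tsum_transverse_lt_top {L a p τ : ℝ} (hL : 0 < L) (ha : 0 < a) (hp : 0 ≤ p) (hτ : 0 < τ) :
    ∑' (m : ℤ × ℤ) (n : ℕ), ENNReal.ofReal ((kSq L m + nu a (n + 1) ^ 2) ^ p *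
      Real.exp (-(τ * (kSq L m + nu a (n + 1) ^ 2)))) < ⊤ := by
  obtain ⟨C, hC0, hC⟩ := exists_heatPower_symbol_le hp hτ
  have hle : ∀ (m : ℤ × ℤ) (n : ℕ), ENNReal.ofReal ((kSq L m + nu a (n + 1) ^ 2) ^ p *
      Real.exp (-(τ * (kSq L m + nu a (n + 1) ^ 2)))) ≤
      ENNReal.ofReal C * (ENNReal.ofReal (Real.exp (-(τ / 2 * kSq L m))) *
        ENNReal.ofReal (Real.exp (-(τ / 2 * nu a (n + 1) ^ 2)))) := by
    intro m n
    rw [← ENNReal.ofReal_mul (Real.exp_pos _).le, ← Real.exp_add, ← ENNReal.ofReal_mul hC0]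
    refine ENNReal.ofReal_le_ofReal ((hC _ (add_nonneg (kSq_nonneg L m) (sq_nonneg _))).trans_eq ?_)
    ring_nf
  refine lt_of_le_of_lt (ENNReal.tsum_le_tsum fun m => ENNReal.tsum_le_tsum (hle m)) ?_
  simp only [ENNReal.tsum_mul_left, ENNReal.tsum_mul_right]
  exact ENNReal.mul_lt_top ENNReal.ofReal_lt_top (ENNReal.mul_lt_top
    (tsum_ofReal_exp_neg_kSq_lt_top hL (half_pos hτ))
    (tsum_ofReal_exp_neg_nu_lt_top ha (half_pos hτ)))

/-- The sum over the modes that do not depend on the plate variable is finite. -/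
theorem tsum_lateral_lt_top {L p τ : ℝ} (hL : 0 < L) (hp : 0 ≤ p) (hτ : 0 < τ) :
    ∑' m : {m : ℤ × ℤ // m ≠ 0}, ENNReal.ofReal (kSq L m ^ p * Real.exp (-(τ * kSq L m))) < ⊤ := by
  obtain ⟨C, hC0, hC⟩ := exists_heatPower_symbol_le hp hτ
  refine lt_of_le_of_lt (ENNReal.tsum_comp_le_tsum_of_injective Subtype.val_injective
    fun m : ℤ × ℤ => ENNReal.ofReal (kSq L m ^ p * Real.exp (-(τ * kSq L m)))) ?_
  refine lt_of_le_of_lt (ENNReal.tsum_le_tsum fun m => (ENNReal.ofReal_le_ofReal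
    (hC _ (kSq_nonneg L m))).trans_eq (ENNReal.ofReal_mul hC0)) ?_
  rw [ENNReal.tsum_mul_left]
  exact ENNReal.mul_lt_top ENNReal.ofReal_lt_top (tsum_ofReal_exp_neg_kSq_lt_top hL (half_pos hτ))

/-! ### Integration by parts on the slab -/

/-- The divergence theorem for the field whose only component is `f`, in direction `i`: opposite
lateral faces cancel by periodicity, and the plates matter only for `i = 2`. Vanishing on the
plates, instead of near them, is what the conducting condition provides, and it is asked only for
normal derivatives. -/
theorem integral_partialDeriv_eq_zero_of_plates {L a : ℝ} (hL : 0 < L) (ha : 0 < a) {f : Pt → ℂ}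
    (hf : IsSmoothPeriodic L f) (i : Fin 3)
    (hf0 : i = 2 → ∀ x : Pt, (x 2 = 0 ∨ x 2 = a) → f x = 0) :
    ∫ x in slab L a, partialDeriv i f x = 0 := by
  have hae : slab L a =ᵐ[volume] Set.Icc (0 : Pt) ![L, L, a] := by
    rw [volume_pi]
    exact Measure.univ_pi_Ioo_ae_eq_Icc
  have hle : (0 : Pt) ≤ ![L, L, a] := by
    intro j; fin_cases j <;> simp [hL.le, ha.le]
  have hd : ∀ x, HasFDerivAt f (fderiv ℝ f x) x := fun x =>
    (hf.contDiff.differentiable (by simp) x).hasFDerivAt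
  have key := integral_divergence_of_hasFDerivAt_off_countable' (n := 2) (0 : Pt) ![L, L, a] hle
    (fun j => if j = i then f else 0) (fun j x => if j = i then fderiv ℝ f x else 0) ∅
    countable_empty
    (fun j => by
      by_cases h : j = i
      · simpa [h] using hf.contDiff.continuous.continuousOn
      · simp only [h, if_false]; exact continuousOn_const)
    (fun x _ j => by
      by_cases h : j = i
      · simpa [h] using hd x
      · simp only [h, if_false]; exact hasFDerivAt_const (0 : ℂ) x)
    (by
      refine Continuous.integrableOn_Icc ?_
      refine continuous_finsetSum _ fun j _ => ?_
      by_cases h : j = i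
      · simpa only [h, if_true] using! (contDiff_partialDeriv hf.contDiff i).continuous
      · simpa [h] using continuous_const)
  rw [setIntegral_congr_set hae]
  have e1 : ∀ x, (∑ j : Fin 3, (if j = i then fderiv ℝ f x else 0) (Pi.single j 1))
      = partialDeriv i f x := by
    intro x
    rw [Finset.sum_eq_single i]
    · simp [partialDeriv]
    · intro j _ hj; simp [hj]
    · simp
  simp only [e1] at key
  rw [key]
  refine Finset.sum_eq_zero fun j _ => ?_
  by_cases h : j = i
  · subst h
    simp only [if_true]
    have face : ∀ y : Fin 2 → ℝ, f (j.insertNth ((![L, L, a] : Pt) j) y)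
        = f (j.insertNth ((0 : Pt) j) y) := by
      intro y
      fin_cases j
      · rw [← hf.periodic_x (Fin.insertNth _ ((0 : Pt) _) y)]
        congr 1; ext k; fin_cases k <;> simp [Fin.insertNth] <;> rfl
      · rw [← hf.periodic_y (Fin.insertNth _ ((0 : Pt) _) y)]
        congr 1; ext k; fin_cases k <;> simp [Fin.insertNth] <;> rfl
      · rw [hf0 rfl _ (Or.inr ?_), hf0 rfl _ (Or.inl ?_)]
        · simp [Fin.insertNth]
        · simp [Fin.insertNth]
    simp only [face, sub_self]
  · simp [h]

theorem IsSmoothPeriodic.mul {L : ℝ} {f g : Pt → ℂ} (hf : IsSmoothPeriodic L f)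
    (hg : IsSmoothPeriodic L g) : IsSmoothPeriodic L (fun x => f x * g x) :=
  ⟨hf.contDiff.mul hg.contDiff, fun x => by simp only [hf.periodic_x, hg.periodic_x],
    fun x => by simp only [hf.periodic_y, hg.periodic_y]⟩

theorem IsSmoothPeriodic.conj {L : ℝ} {f : Pt → ℂ} (hf : IsSmoothPeriodic L f) :
    IsSmoothPeriodic L (fun x => (starRingEnd ℂ) (f x)) :=
  ⟨Complex.conjCLE.contDiff.comp hf.contDiff, fun x => by simp only [hf.periodic_x],
    fun x => by simp only [hf.periodic_y]⟩

theorem partialDeriv_conj {f : Pt → ℂ} (hf : ContDiff ℝ ∞ f) (i : Fin 3) (x : Pt) :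
    partialDeriv i (fun y => (starRingEnd ℂ) (f y)) x = (starRingEnd ℂ) (partialDeriv i f x) := by
  have h : HasFDerivAt f (fderiv ℝ f x) x := (hf.differentiable (by simp) x).hasFDerivAt
  have h2 := (Complex.conjCLE.hasFDerivAt (x := f x)).comp x h
  have h3 : fderiv ℝ (fun y => (starRingEnd ℂ) (f y)) x = _ := h2.fderiv
  unfold partialDeriv
  rw [h3]
  simp

theorem partialDeriv_mul {f g : Pt → ℂ} (hf : ContDiff ℝ ∞ f) (hg : ContDiff ℝ ∞ g) (i : Fin 3)
    (x : Pt) : partialDeriv i (fun y => f y * g y) x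
      = partialDeriv i f x * g x + f x * partialDeriv i g x := by
  have h1 := hf.differentiable (by simp) x
  have h2 := hg.differentiable (by simp) x
  unfold partialDeriv
  rw [fderiv_fun_mul h1 h2]
  simp only [add_apply, smul_apply, smul_eq_mul]
  ring

/-- Integration by parts on the slab. -/
theorem integral_conj_partialDeriv_mul {L a : ℝ} (hL : 0 < L) (ha : 0 < a) {f g : Pt → ℂ}
    (hf : IsSmoothPeriodic L f) (hg : IsSmoothPeriodic L g) (i : Fin 3)
    (h0 : i = 2 → ∀ x : Pt, (x 2 = 0 ∨ x 2 = a) → f x = 0) :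
    ∫ x in slab L a, (starRingEnd ℂ) (partialDeriv i f x) * g x
      = -∫ x in slab L a, (starRingEnd ℂ) (f x) * partialDeriv i g x := by
  have h := integral_partialDeriv_eq_zero_of_plates hL ha (hf.conj.mul hg) i
    fun hi x hx => by simp [h0 hi x hx]
  have hc := (hf.conj.contDiff).continuous
  have hc' : Continuous fun x => (starRingEnd ℂ) (partialDeriv i f x) :=
    Complex.continuous_conj.comp (contDiff_partialDeriv hf.contDiff i).continuous
  simp only [partialDeriv_mul hf.conj.contDiff hg.contDiff, partialDeriv_conj hf.contDiff] at h
  rw [integral_add (integrableOn_slab (hc'.fun_mul hg.contDiff.continuous))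
    (integrableOn_slab (hc.fun_mul (contDiff_partialDeriv hg.contDiff i).continuous))] at h
  exact eq_neg_of_add_eq_zero_left h

theorem inner_vec (u v : Vec) : ⟪u, v⟫_ℂ = (starRingEnd ℂ) (u 0) * v 0
    + (starRingEnd ℂ) (u 1) * v 1 + (starRingEnd ℂ) (u 2) * v 2 := by
  simp only [PiLp.inner_apply, Fin.sum_univ_three, RCLike.inner_apply]
  ring

/-- The curl is symmetric if the tangential components of one of the two fields vanish on the
plates. -/
theorem integral_inner_curl {L a : ℝ} (hL : 0 < L) (ha : 0 < a) {E F : Pt → Vec}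
    (hE : IsSmoothPeriodic L E) (hF : IsSmoothPeriodic L F)
    (h0 : ∀ x : Pt, (x 2 = 0 ∨ x 2 = a) → E x 0 = 0 ∧ E x 1 = 0) :
    ∫ x in slab L a, ⟪curl E x, F x⟫_ℂ = ∫ x in slab L a, ⟪E x, curl F x⟫_ℂ := by
  have e := fun j => isSmoothPeriodic_coord hE j
  have f := fun j => isSmoothPeriodic_coord hF j
  -- The curl never differentiates the normal component in the normal direction, so the plate terms
  -- involve only `E x 0` and `E x 1`, which vanish there.
  have ibp : ∀ i j k : Fin 3, (i = 2 → j ≠ 2) →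
      ∫ x in slab L a, (starRingEnd ℂ) (partialDeriv i (fun y => E y j) x) * F x k
      = -∫ x in slab L a, (starRingEnd ℂ) (E x j) * partialDeriv i (fun y => F y k) x := by
    intro i j k hij
    refine integral_conj_partialDeriv_mul hL ha (e j) (f k) i fun hi x hx => ?_
    have := h0 x hx
    have hj := hij hi
    fin_cases j
    · exact this.1
    · exact this.2
    · exact absurd rfl hj
  have i1 : ∀ i j k : Fin 3, Integrable
      (fun x => (starRingEnd ℂ) (partialDeriv i (fun y => E y j) x) * F x k) (volume.restrict (slab L a)) :=
    fun i j k => integrableOn_slab ((Complex.continuous_conj.comp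
      (contDiff_partialDeriv (e j).contDiff i).continuous).mul (f k).contDiff.continuous)
  have i2 : ∀ i j k : Fin 3, Integrable
      (fun x => (starRingEnd ℂ) (E x j) * partialDeriv i (fun y => F y k) x) (volume.restrict (slab L a)) :=
    fun i j k => integrableOn_slab ((Complex.continuous_conj.comp
      (e j).contDiff.continuous).mul (contDiff_partialDeriv (f k).contDiff i).continuous)
  have l : ∀ x, ⟪curl E x, F x⟫_ℂ =
      ((starRingEnd ℂ) (partialDeriv 1 (fun y => E y 2) x) * F x 0
      - (starRingEnd ℂ) (partialDeriv 2 (fun y => E y 1) x) * F x 0)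
      + ((starRingEnd ℂ) (partialDeriv 2 (fun y => E y 0) x) * F x 1
      - (starRingEnd ℂ) (partialDeriv 0 (fun y => E y 2) x) * F x 1)
      + ((starRingEnd ℂ) (partialDeriv 0 (fun y => E y 1) x) * F x 2
      - (starRingEnd ℂ) (partialDeriv 1 (fun y => E y 0) x) * F x 2) := by
    intro x
    rw [inner_vec]
    simp [curl]
    ring
  have r : ∀ x, ⟪E x, curl F x⟫_ℂ =
      ((starRingEnd ℂ) (E x 0) * partialDeriv 1 (fun y => F y 2) x
      - (starRingEnd ℂ) (E x 0) * partialDeriv 2 (fun y => F y 1) x)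
      + ((starRingEnd ℂ) (E x 1) * partialDeriv 2 (fun y => F y 0) x
      - (starRingEnd ℂ) (E x 1) * partialDeriv 0 (fun y => F y 2) x)
      + ((starRingEnd ℂ) (E x 2) * partialDeriv 0 (fun y => F y 1) x
      - (starRingEnd ℂ) (E x 2) * partialDeriv 1 (fun y => F y 0) x) := by
    intro x
    rw [inner_vec]
    simp [curl]
    ring
  have sub : ∀ {u v : Pt → ℂ}, Integrable u (volume.restrict (slab L a)) →
      Integrable v (volume.restrict (slab L a)) →
      Integrable (fun x => u x - v x) (volume.restrict (slab L a)) := fun hu hv => hu.sub hv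
  simp only [l, r]
  rw [integral_add ((sub (i1 _ _ _) (i1 _ _ _)).fun_add (sub (i1 _ _ _) (i1 _ _ _)))
      (sub (i1 _ _ _) (i1 _ _ _)),
    integral_add (sub (i1 _ _ _) (i1 _ _ _)) (sub (i1 _ _ _) (i1 _ _ _)),
    integral_sub (i1 _ _ _) (i1 _ _ _), integral_sub (i1 _ _ _) (i1 _ _ _),
    integral_sub (i1 _ _ _) (i1 _ _ _),
    integral_add ((sub (i2 _ _ _) (i2 _ _ _)).fun_add (sub (i2 _ _ _) (i2 _ _ _)))
      (sub (i2 _ _ _) (i2 _ _ _)),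
    integral_add (sub (i2 _ _ _) (i2 _ _ _)) (sub (i2 _ _ _) (i2 _ _ _)),
    integral_sub (i2 _ _ _) (i2 _ _ _), integral_sub (i2 _ _ _) (i2 _ _ _),
    integral_sub (i2 _ _ _) (i2 _ _ _),
    ibp 1 2 0 (by decide), ibp 2 1 0 (by decide), ibp 2 0 1 (by decide), ibp 0 2 1 (by decide),
    ibp 0 1 2 (by decide), ibp 1 0 2 (by decide)]
  ring

/-- A smooth field with vanishing divergence is orthogonal to the gradients of the functions that
vanish on the plates. -/
theorem integral_inner_grad_eq_zero {L a : ℝ} (hL : 0 < L) (ha : 0 < a) {φ : Pt → ℂ} {E : Pt → Vec}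
    (hφ : IsSmoothPeriodic L φ) (hE : IsSmoothPeriodic L E)
    (h0 : ∀ x : Pt, (x 2 = 0 ∨ x 2 = a) → φ x = 0)
    (hdiv : ∀ x, partialDeriv 0 (fun y => E y 0) x + partialDeriv 1 (fun y => E y 1) x
      + partialDeriv 2 (fun y => E y 2) x = 0) :
    ∫ x in slab L a, ⟪grad φ x, E x⟫_ℂ = 0 := by
  have e := fun j => isSmoothPeriodic_coord hE j
  have i1 : ∀ j : Fin 3, Integrable
      (fun x => (starRingEnd ℂ) (partialDeriv j φ x) * E x j) (volume.restrict (slab L a)) :=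
    fun j => integrableOn_slab ((Complex.continuous_conj.comp
      (contDiff_partialDeriv hφ.contDiff j).continuous).mul (e j).contDiff.continuous)
  have i2 : ∀ j : Fin 3, Integrable
      (fun x => (starRingEnd ℂ) (φ x) * partialDeriv j (fun y => E y j) x) (volume.restrict (slab L a)) :=
    fun j => integrableOn_slab ((Complex.continuous_conj.comp
      hφ.contDiff.continuous).mul (contDiff_partialDeriv (e j).contDiff j).continuous)
  have l : ∀ x, ⟪grad φ x, E x⟫_ℂ = (starRingEnd ℂ) (partialDeriv 0 φ x) * E x 0
      + (starRingEnd ℂ) (partialDeriv 1 φ x) * E x 1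
      + (starRingEnd ℂ) (partialDeriv 2 φ x) * E x 2 := fun x => inner_vec _ _
  simp only [l]
  have ibp := fun j => integral_conj_partialDeriv_mul hL ha hφ (e j) j fun _ => h0
  rw [integral_add ((i1 0).fun_add (i1 1)) (i1 2), integral_add (i1 0) (i1 1), ibp, ibp, ibp,
    ← neg_add, ← neg_add, ← integral_add (i2 0) (i2 1), ← integral_add ((i2 0).fun_add (i2 1)) (i2 2),
    neg_eq_zero]
  simp only [← mul_add, hdiv, mul_zero, integral_zero]

/-! ### Separated modes, their curls and divergences -/

/-- The lateral wave number `2 π m / L`. -/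
def waveNumber (L : ℝ) (m : ℤ) : ℝ := 2 * Real.pi / L * m

/-- The lateral wave `t ↦ exp (i k t)`, `k = 2 π m / L`. -/
def lateralWave (L : ℝ) (m : ℤ) (t : ℝ) : ℂ := Complex.exp (Complex.I * waveNumber L m * t)

/-- The function `t ↦ sin (ν_n t)`. -/
def plateSin (a : ℝ) (n : ℕ) (t : ℝ) : ℂ := (Real.sin (nu a n * t) : ℝ)

/-- The function `t ↦ cos (ν_n t)`. -/
def plateCos (a : ℝ) (n : ℕ) (t : ℝ) : ℂ := (Real.cos (nu a n * t) : ℝ)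

/-- The product of functions of the three coordinates. -/
def separated (A B Z : ℝ → ℂ) (x : Pt) : ℂ := A (x 0) * B (x 1) * Z (x 2)

/-- The scalar mode `exp (i k_m · (x, y)) sin (ν_n z)`. -/
def sinMode (L a : ℝ) (m : ℤ × ℤ) (n : ℕ) : Pt → ℂ :=
  separated (lateralWave L m.1) (lateralWave L m.2) (plateSin a n)

/-- The scalar mode `exp (i k_m · (x, y)) cos (ν_n z)`. -/
def cosMode (L a : ℝ) (m : ℤ × ℤ) (n : ℕ) : Pt → ℂ :=
  separated (lateralWave L m.1) (lateralWave L m.2) (plateCos a n)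

/-- The electric mode with polarization `u`. -/
def electricMode (L a : ℝ) (m : ℤ × ℤ) (n : ℕ) (u : Vec) (x : Pt) : Vec :=
  !₂[u 0 * sinMode L a m n x, u 1 * sinMode L a m n x, u 2 * cosMode L a m n x]

/-- The magnetic mode with polarization `w`. -/
def magneticMode (L a : ℝ) (m : ℤ × ℤ) (n : ℕ) (w : Vec) (x : Pt) : Vec :=
  !₂[w 0 * cosMode L a m n x, w 1 * cosMode L a m n x, w 2 * sinMode L a m n x]

/-- The direction of the gradient of `sinMode`. -/
def gradDirection (L a : ℝ) (m : ℤ × ℤ) (n : ℕ) : Vec :=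
  !₂[Complex.I * waveNumber L m.1, Complex.I * waveNumber L m.2, (nu a n : ℂ)]

theorem kSq_eq (L : ℝ) (m : ℤ × ℤ) : kSq L m = waveNumber L m.1 ^ 2 + waveNumber L m.2 ^ 2 := rfl

theorem hasDerivAt_lateralWave (L : ℝ) (m : ℤ) (t : ℝ) :
    HasDerivAt (lateralWave L m) (Complex.I * waveNumber L m * lateralWave L m t) t := by
  have h := ((Complex.ofRealCLM.hasDerivAt (x := t)).const_mul
    (Complex.I * waveNumber L m)).cexp
  convert! h using 1
  simp [lateralWave]
  ring

theorem hasDerivAt_plateSin (a : ℝ) (n : ℕ) (t : ℝ) :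
    HasDerivAt (plateSin a n) (nu a n * plateCos a n t) t := by
  have h := (((hasDerivAt_id t).const_mul (nu a n)).sin).ofReal_comp
  convert! h using 1
  simp [plateCos]
  ring

theorem hasDerivAt_plateCos (a : ℝ) (n : ℕ) (t : ℝ) :
    HasDerivAt (plateCos a n) (-(nu a n * plateSin a n t)) t := by
  have h := (((hasDerivAt_id t).const_mul (nu a n)).cos).ofReal_comp
  convert! h using 1
  simp [plateSin]
  ring

theorem contDiff_lateralWave (L : ℝ) (m : ℤ) : ContDiff ℝ ∞ (lateralWave L m) :=
  (contDiff_const.mul Complex.ofRealCLM.contDiff).cexp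

theorem contDiff_plateSin (a : ℝ) (n : ℕ) : ContDiff ℝ ∞ (plateSin a n) :=
  Complex.ofRealCLM.contDiff.comp (contDiff_const.mul contDiff_id).sin

theorem contDiff_plateCos (a : ℝ) (n : ℕ) : ContDiff ℝ ∞ (plateCos a n) :=
  Complex.ofRealCLM.contDiff.comp (contDiff_const.mul contDiff_id).cos

theorem lateralWave_add_period {L : ℝ} (hL : 0 < L) (m : ℤ) (t : ℝ) :
    lateralWave L m (t + L) = lateralWave L m t := by
  have hL' : (L : ℂ) ≠ 0 := by exact_mod_cast hL.ne'
  unfold lateralWave waveNumber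
  rw [Complex.exp_eq_exp_iff_exists_int]
  refine ⟨m, ?_⟩
  push_cast
  field_simp

theorem contDiff_separated {A B Z : ℝ → ℂ} (hA : ContDiff ℝ ∞ A) (hB : ContDiff ℝ ∞ B)
    (hZ : ContDiff ℝ ∞ Z) : ContDiff ℝ ∞ (separated A B Z) :=
  ((hA.comp (contDiff_apply ℝ ℝ 0)).mul (hB.comp (contDiff_apply ℝ ℝ 1))).mul
    (hZ.comp (contDiff_apply ℝ ℝ 2))

theorem isSmoothPeriodic_separated {L : ℝ} (hL : 0 < L) (m : ℤ × ℤ) {Z : ℝ → ℂ}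
    (hZ : ContDiff ℝ ∞ Z) :
    IsSmoothPeriodic L (separated (lateralWave L m.1) (lateralWave L m.2) Z) :=
  ⟨contDiff_separated (contDiff_lateralWave _ _) (contDiff_lateralWave _ _) hZ,
    fun x => by simp [separated, lateralWave_add_period hL],
    fun x => by simp [separated, lateralWave_add_period hL]⟩

theorem isSmoothPeriodic_sinMode {L : ℝ} (hL : 0 < L) (a : ℝ) (m : ℤ × ℤ) (n : ℕ) :
    IsSmoothPeriodic L (sinMode L a m n) := isSmoothPeriodic_separated hL m (contDiff_plateSin a n)

theorem isSmoothPeriodic_cosMode {L : ℝ} (hL : 0 < L) (a : ℝ) (m : ℤ × ℤ) (n : ℕ) :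
    IsSmoothPeriodic L (cosMode L a m n) := isSmoothPeriodic_separated hL m (contDiff_plateCos a n)

theorem hasFDerivAt_comp_apply {A : ℝ → ℂ} {A' : ℂ} {x : Pt} {i : Fin 3}
    (hA : HasDerivAt A A' (x i)) :
    HasFDerivAt (fun y : Pt => A (y i))
      ((ContinuousLinearMap.toSpanSingleton ℝ A').comp
        (ContinuousLinearMap.proj (R := ℝ) (φ := fun _ : Fin 3 => ℝ) i)) x :=
  hA.hasFDerivAt.comp x (ContinuousLinearMap.proj (R := ℝ) (φ := fun _ : Fin 3 => ℝ) i).hasFDerivAt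

theorem partialDeriv_separated {A B Z : ℝ → ℂ} {A' B' Z' : ℂ} {x : Pt}
    (hA : HasDerivAt A A' (x 0)) (hB : HasDerivAt B B' (x 1)) (hZ : HasDerivAt Z Z' (x 2)) :
    partialDeriv 0 (separated A B Z) x = A' * B (x 1) * Z (x 2) ∧
    partialDeriv 1 (separated A B Z) x = A (x 0) * B' * Z (x 2) ∧
    partialDeriv 2 (separated A B Z) x = A (x 0) * B (x 1) * Z' := by
  have h : fderiv ℝ (separated A B Z) x = _ :=
    (((hasFDerivAt_comp_apply hA).mul (hasFDerivAt_comp_apply hB)).mul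
      (hasFDerivAt_comp_apply hZ)).fderiv
  unfold partialDeriv
  rw [h]
  refine ⟨?_, ?_, ?_⟩ <;> simp <;> ring

theorem partialDeriv_sinMode (L a : ℝ) (m : ℤ × ℤ) (n : ℕ) (x : Pt) :
    partialDeriv 0 (sinMode L a m n) x = Complex.I * waveNumber L m.1 * sinMode L a m n x ∧
    partialDeriv 1 (sinMode L a m n) x = Complex.I * waveNumber L m.2 * sinMode L a m n x ∧
    partialDeriv 2 (sinMode L a m n) x = nu a n * cosMode L a m n x := by
  obtain ⟨h0, h1, h2⟩ := partialDeriv_separated (hasDerivAt_lateralWave L m.1 (x 0))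
    (hasDerivAt_lateralWave L m.2 (x 1)) (hasDerivAt_plateSin a n (x 2))
  unfold sinMode cosMode
  rw [h0, h1, h2]
  refine ⟨?_, ?_, ?_⟩ <;> simp only [separated] <;> ring

theorem partialDeriv_cosMode (L a : ℝ) (m : ℤ × ℤ) (n : ℕ) (x : Pt) :
    partialDeriv 0 (cosMode L a m n) x = Complex.I * waveNumber L m.1 * cosMode L a m n x ∧
    partialDeriv 1 (cosMode L a m n) x = Complex.I * waveNumber L m.2 * cosMode L a m n x ∧
    partialDeriv 2 (cosMode L a m n) x = -(nu a n * sinMode L a m n x) := by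
  obtain ⟨h0, h1, h2⟩ := partialDeriv_separated (hasDerivAt_lateralWave L m.1 (x 0))
    (hasDerivAt_lateralWave L m.2 (x 1)) (hasDerivAt_plateCos a n (x 2))
  unfold sinMode cosMode
  rw [h0, h1, h2]
  refine ⟨?_, ?_, ?_⟩ <;> simp only [separated] <;> ring

theorem partialDeriv_const_mul (c : ℂ) {f : Pt → ℂ} (hf : ContDiff ℝ ∞ f) (i : Fin 3) (x : Pt) :
    partialDeriv i (fun y => c * f y) x = c * partialDeriv i f x := by
  unfold partialDeriv
  rw [fderiv_const_mul (hf.differentiable (by simp) x)]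
  rfl

theorem isSmoothPeriodic_electricMode {L : ℝ} (hL : 0 < L) (a : ℝ) (m : ℤ × ℤ) (n : ℕ) (u : Vec) :
    IsSmoothPeriodic L (electricMode L a m n u) := by
  have hs := isSmoothPeriodic_sinMode hL a m n
  have hc := isSmoothPeriodic_cosMode hL a m n
  refine ⟨?_, fun x => by simp only [electricMode, hs.periodic_x, hc.periodic_x],
    fun x => by simp only [electricMode, hs.periodic_y, hc.periodic_y]⟩
  refine (PiLp.continuousLinearEquiv 2 ℝ fun _ : Fin 3 => ℂ).symm.contDiff.comp
    (contDiff_pi.2 fun i => ?_)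
  fin_cases i
  · exact contDiff_const.mul hs.contDiff
  · exact contDiff_const.mul hs.contDiff
  · exact contDiff_const.mul hc.contDiff

theorem isSmoothPeriodic_magneticMode {L : ℝ} (hL : 0 < L) (a : ℝ) (m : ℤ × ℤ) (n : ℕ) (u : Vec) :
    IsSmoothPeriodic L (magneticMode L a m n u) := by
  have hs := isSmoothPeriodic_sinMode hL a m n
  have hc := isSmoothPeriodic_cosMode hL a m n
  refine ⟨?_, fun x => by simp only [magneticMode, hs.periodic_x, hc.periodic_x],
    fun x => by simp only [magneticMode, hs.periodic_y, hc.periodic_y]⟩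
  refine (PiLp.continuousLinearEquiv 2 ℝ fun _ : Fin 3 => ℂ).symm.contDiff.comp
    (contDiff_pi.2 fun i => ?_)
  fin_cases i
  · exact contDiff_const.mul hc.contDiff
  · exact contDiff_const.mul hc.contDiff
  · exact contDiff_const.mul hs.contDiff

/-- The polarization of the curl of an electric mode. -/
def curlPolarization (L a : ℝ) (m : ℤ × ℤ) (n : ℕ) (u : Vec) : Vec :=
  !₂[Complex.I * waveNumber L m.2 * u 2 - nu a n * u 1,
    nu a n * u 0 - Complex.I * waveNumber L m.1 * u 2,
    Complex.I * waveNumber L m.1 * u 1 - Complex.I * waveNumber L m.2 * u 0]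

theorem curl_electricMode {L : ℝ} (hL : 0 < L) (a : ℝ) (m : ℤ × ℤ) (n : ℕ) (u : Vec) :
    curl (electricMode L a m n u) = magneticMode L a m n (curlPolarization L a m n u) := by
  have hs := (isSmoothPeriodic_sinMode hL a m n).contDiff
  have hc := (isSmoothPeriodic_cosMode hL a m n).contDiff
  ext x i
  obtain ⟨s0, s1, s2⟩ := partialDeriv_sinMode L a m n x
  obtain ⟨c0, c1, c2⟩ := partialDeriv_cosMode L a m n x
  fin_cases i <;>
    simp [curl, electricMode, magneticMode, curlPolarization, partialDeriv_const_mul _ hs,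
      partialDeriv_const_mul _ hc, s0, s1, s2, c0, c1] <;> ring

/-- The bracket is, up to the factor `sinMode`, the divergence of the electric mode. Orthogonality
to `gradDirection` is thus transversality, the condition `hu` in what follows; the minus sign comes
from conjugating `i`. -/
theorem inner_gradDirection (L a : ℝ) (m : ℤ × ℤ) (n : ℕ) (u : Vec) :
    ⟪gradDirection L a m n, u⟫_ℂ = -(Complex.I * waveNumber L m.1 * u 0
      + Complex.I * waveNumber L m.2 * u 1 - nu a n * u 2) := by
  rw [inner_vec]
  simp [gradDirection]
  ring

/-- This is curl curl = `-Δ` + grad div on a mode: `hu` kills the gradient of the divergence, and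
`-Δ` multiplies every component by `|k_m|² + ν_n²`. -/
theorem curl_magneticMode {L : ℝ} (hL : 0 < L) (a : ℝ) (m : ℤ × ℤ) (n : ℕ) {u : Vec}
    (hu : ⟪gradDirection L a m n, u⟫_ℂ = 0) :
    curl (magneticMode L a m n (curlPolarization L a m n u))
      = ((kSq L m + nu a n ^ 2 : ℝ) : ℂ) • electricMode L a m n u := by
  have hs := (isSmoothPeriodic_sinMode hL a m n).contDiff
  have hc := (isSmoothPeriodic_cosMode hL a m n).contDiff
  rw [inner_gradDirection, neg_eq_zero] at hu
  have hI := Complex.I_sq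
  ext x i
  obtain ⟨s0, s1, s2⟩ := partialDeriv_sinMode L a m n x
  obtain ⟨c0, c1, c2⟩ := partialDeriv_cosMode L a m n x
  fin_cases i
  · simp [curl, electricMode, magneticMode, curlPolarization, partialDeriv_const_mul _ hs,
      partialDeriv_const_mul _ hc, s1, c2, kSq_eq]
    linear_combination (Complex.I * waveNumber L m.1 * sinMode L a m n x) * hu
      - (waveNumber L m.1 ^ 2 + waveNumber L m.2 ^ 2) * u 0 * sinMode L a m n x * hI
  · simp [curl, electricMode, magneticMode, curlPolarization, partialDeriv_const_mul _ hs,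
      partialDeriv_const_mul _ hc, s0, c2, kSq_eq]
    linear_combination (Complex.I * waveNumber L m.2 * sinMode L a m n x) * hu
      - (waveNumber L m.1 ^ 2 + waveNumber L m.2 ^ 2) * u 1 * sinMode L a m n x * hI
  · simp [curl, electricMode, magneticMode, curlPolarization,
      partialDeriv_const_mul _ hc, c0, c1, kSq_eq]
    linear_combination (nu a n * cosMode L a m n x) * hu
      - (waveNumber L m.1 ^ 2 + waveNumber L m.2 ^ 2) * u 2 * cosMode L a m n x * hI

theorem div_electricMode {L : ℝ} (hL : 0 < L) (a : ℝ) (m : ℤ × ℤ) (n : ℕ) {u : Vec}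
    (hu : ⟪gradDirection L a m n, u⟫_ℂ = 0) (x : Pt) :
    partialDeriv 0 (fun y => electricMode L a m n u y 0) x
      + partialDeriv 1 (fun y => electricMode L a m n u y 1) x
      + partialDeriv 2 (fun y => electricMode L a m n u y 2) x = 0 := by
  have hs := (isSmoothPeriodic_sinMode hL a m n).contDiff
  have hc := (isSmoothPeriodic_cosMode hL a m n).contDiff
  obtain ⟨s0, s1, s2⟩ := partialDeriv_sinMode L a m n x
  obtain ⟨c0, c1, c2⟩ := partialDeriv_cosMode L a m n x
  rw [inner_gradDirection, neg_eq_zero] at hu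
  simp [electricMode, partialDeriv_const_mul _ hs, partialDeriv_const_mul _ hc, s0, s1, c2]
  linear_combination sinMode L a m n x * hu

theorem sinMode_eq_zero_of_plates {L a : ℝ} (ha : 0 < a) (m : ℤ × ℤ) (n : ℕ) {x : Pt}
    (hx : x 2 = 0 ∨ x 2 = a) : sinMode L a m n x = 0 := by
  have : plateSin a n (x 2) = 0 := by
    rcases hx with hx | hx
    · simp [plateSin, hx]
    · rw [plateSin, hx, nu, div_mul_cancel₀ _ ha.ne', mul_comm, Real.sin_nat_mul_pi]
      simp
  simp [sinMode, separated, this]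

/-! ### Electric modes in the form domain -/

/-- The electric modes, as a linear function of the polarization with values in `L²`. -/
def electricField {L : ℝ} (hL : 0 < L) (a : ℝ) (m : ℤ × ℤ) (n : ℕ) : Vec →ₗ[ℂ] L2Field L a where
  toFun u := (memLp_slab L a (isSmoothPeriodic_electricMode hL a m n u).contDiff.continuous).toLp
    (electricMode L a m n u)
  map_add' u v := by
    rw [← MemLp.toLp_add]
    congr 1
    ext x i
    fin_cases i <;> simp [electricMode, add_mul]
  map_smul' c u := by
    rw [RingHom.id_apply, ← MemLp.toLp_const_smul]
    congr 1
    ext x i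
    fin_cases i <;> simp [electricMode, mul_assoc]

/-- The curl of the electric modes, in `L²`. -/
def magneticField {L : ℝ} (hL : 0 < L) (a : ℝ) (m : ℤ × ℤ) (n : ℕ) (w : Vec) : L2Field L a :=
  (memLp_slab L a (isSmoothPeriodic_magneticMode hL a m n w).contDiff.continuous).toLp
    (magneticMode L a m n w)

theorem electricField_coeFn {L : ℝ} (hL : 0 < L) (a : ℝ) (m : ℤ × ℤ) (n : ℕ) (u : Vec) :
    electricField hL a m n u =ᵐ[volume.restrict (slab L a)] electricMode L a m n u :=
  (memLp_slab L a (isSmoothPeriodic_electricMode hL a m n u).contDiff.continuous).coeFn_toLp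

theorem inner_electricField {L : ℝ} (hL : 0 < L) (a : ℝ) (m : ℤ × ℤ) (n : ℕ) (u : Vec)
    (G : L2Field L a) :
    ⟪electricField hL a m n u, G⟫_ℂ = ∫ x in slab L a, ⟪electricMode L a m n u x, G x⟫_ℂ :=
  (integral_inner_eq L a (isSmoothPeriodic_electricMode hL a m n u).contDiff.continuous G).symm

/-- The mode is itself one of the smooth fields with the plate condition, so no approximation is
needed. The weak curl and weak divergence follow by parts, the plate terms being removed by the test
functions. -/
theorem electricField_mem_pecGraph {L a : ℝ} (hL : 0 < L) (ha : 0 < a) (m : ℤ × ℤ) (n : ℕ)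
    {u : Vec} (hu : ⟪gradDirection L a m n, u⟫_ℂ = 0) :
    WithLp.toLp 2 (electricField hL a m n u, magneticField hL a m n (curlPolarization L a m n u))
      ∈ pecGraph L a := by
  have hE := isSmoothPeriodic_electricMode hL a m n u
  have hB := isSmoothPeriodic_magneticMode hL a m n (curlPolarization L a m n u)
  have hEf := electricField_coeFn hL a m n u
  have hBf : magneticField hL a m n (curlPolarization L a m n u) =ᵐ[volume.restrict (slab L a)]
    magneticMode L a m n (curlPolarization L a m n u) := MemLp.coeFn_toLp _
  refine ⟨fun Φ hΦ h0 => ?_, ?_, fun φ hφ h0 => ?_⟩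
  · obtain ⟨δ, hδ, h0⟩ := h0
    have h := integral_inner_curl hL ha hΦ hE fun x hx => by
      have : Φ x = 0 := h0 x (hx.imp (fun h => by rw [h]; exact hδ) fun h => by rw [h]; linarith)
      simp [this]
    rw [curl_electricMode hL] at h
    refine Eq.trans (integral_congr_ae ?_) (h.trans (integral_congr_ae ?_))
    · filter_upwards [hEf] with x hx
      change ⟪_, electricField hL a m n u x⟫_ℂ = _
      rw [hx]
    · filter_upwards [hBf] with x hx
      change _ = ⟪_, magneticField hL a m n _ x⟫_ℂ
      rw [hx]
  · refine Submodule.le_topologicalClosure _ ⟨electricMode L a m n u, hE, fun x hx => ?_, hEf, ?_⟩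
    · simp [electricMode, sinMode_eq_zero_of_plates ha m n hx]
    · rw [curl_electricMode hL]
      exact hBf
  · obtain ⟨δ, hδ, h0⟩ := h0
    rw [← integral_inner_grad_eq_zero hL ha hφ hE
      (fun x hx => h0 x (hx.imp (fun h => by rw [h]; exact hδ) fun h => by rw [h]; linarith))
      (div_electricMode hL a m n hu)]
    refine integral_congr_ae ?_
    filter_upwards [hEf] with x hx
    change ⟪_, electricField hL a m n u x⟫_ℂ = _
    rw [hx]

/-- The electric modes are eigenvectors of the Maxwell form. -/
theorem inner_magneticField_curl {L a : ℝ} (hL : 0 < L) (ha : 0 < a) (m : ℤ × ℤ) (n : ℕ)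
    {u : Vec} (hu : ⟪gradDirection L a m n, u⟫_ℂ = 0)
    {q : WithLp 2 (L2Field L a × L2Field L a)} (hq : q ∈ pecGraph L a) :
    ⟪q.snd, magneticField hL a m n (curlPolarization L a m n u)⟫_ℂ
      = ⟪q.fst, ((kSq L m + nu a n ^ 2 : ℝ) : ℂ) • electricField hL a m n u⟫_ℂ := by
  have hB := isSmoothPeriodic_magneticMode hL a m n (curlPolarization L a m n u)
  have hf : Continuous fun p : WithLp 2 (L2Field L a × L2Field L a) => p.fst :=
    (WithLp.fstL 2 ℂ (L2Field L a) (L2Field L a)).continuous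
  have hs : Continuous fun p : WithLp 2 (L2Field L a × L2Field L a) => p.snd :=
    (WithLp.sndL 2 ℂ (L2Field L a) (L2Field L a)).continuous
  have hcl : IsClosed {q : WithLp 2 (L2Field L a × L2Field L a) |
      ⟪q.snd, magneticField hL a m n (curlPolarization L a m n u)⟫_ℂ
      = ⟪q.fst, ((kSq L m + nu a n ^ 2 : ℝ) : ℂ) • electricField hL a m n u⟫_ℂ} :=
    isClosed_eq (hs.inner continuous_const) (hf.inner continuous_const)
  -- The identity is closed in the graph norm, so smooth fields with the plate condition suffice.
  -- The condition must come from the field `E` of the pair, because the tangential part of the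
  -- magnetic mode is a cosine and need not vanish on the plates.
  refine closure_minimal (fun q hq => ?_) hcl hq.2.1
  obtain ⟨E, hE, hE0, h1, h2⟩ := hq
  have h := integral_inner_curl hL ha hE hB hE0
  rw [curl_magneticMode hL a m n hu] at h
  change ⟪q.snd, magneticField hL a m n (curlPolarization L a m n u)⟫_ℂ
      = ⟪q.fst, ((kSq L m + nu a n ^ 2 : ℝ) : ℂ) • electricField hL a m n u⟫_ℂ
  rw [L2.inner_def, L2.inner_def]
  refine Eq.trans (integral_congr_ae ?_) (h.trans (integral_congr_ae ?_))
  · have hBf : magneticField hL a m n (curlPolarization L a m n u) =ᵐ[volume.restrict (slab L a)]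
      magneticMode L a m n (curlPolarization L a m n u) := MemLp.coeFn_toLp _
    filter_upwards [hBf, h2] with x hx hx2
    rw [hx, hx2]
  · filter_upwards [electricField_coeFn hL a m n u, h1, Lp.coeFn_smul
      ((kSq L m + nu a n ^ 2 : ℝ) : ℂ) (electricField hL a m n u)] with x hx hx2 hx3
    rw [hx3, Pi.smul_apply, Pi.smul_apply, hx, hx2]

/-! ### Orthogonality relations -/

theorem integral_separated (L a : ℝ) (A B Z : ℝ → ℂ) :
    ∫ x in slab L a, separated A B Z x
      = (∫ t in Ioo 0 L, A t) * (∫ t in Ioo 0 L, B t) * ∫ t in Ioo 0 a, Z t := by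
  have h := integral_fintype_prod_eq_prod (𝕜 := ℂ) (E := fun _ : Fin 3 => ℝ)
    (μ := fun i => volume.restrict (Ioo 0 ((![L, L, a] : Fin 3 → ℝ) i)))
    (![A, B, Z] : Fin 3 → ℝ → ℂ)
  rw [← Measure.restrict_pi_pi, ← volume_pi] at h
  simpa [Fin.prod_univ_three, separated, slab] using h

theorem conj_lateralWave (L : ℝ) (m : ℤ) (t : ℝ) :
    (starRingEnd ℂ) (lateralWave L m t) = lateralWave L (-m) t := by
  rw [lateralWave, ← Complex.exp_conj, map_mul, map_mul, Complex.conj_I, Complex.conj_ofReal,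
    Complex.conj_ofReal, lateralWave, waveNumber, waveNumber]
  push_cast
  ring_nf

theorem lateralWave_mul (L : ℝ) (m k : ℤ) (t : ℝ) :
    lateralWave L m t * lateralWave L k t = lateralWave L (m + k) t := by
  rw [lateralWave, lateralWave, ← Complex.exp_add, lateralWave, waveNumber, waveNumber, waveNumber]
  push_cast
  ring_nf

theorem integral_lateralWave {L : ℝ} (hL : 0 < L) (m : ℤ) :
    ∫ t in Ioo 0 L, lateralWave L m t = if m = 0 then (L : ℂ) else 0 := by
  rw [← integral_Ioc_eq_integral_Ioo, ← intervalIntegral.integral_of_le hL.le]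
  split_ifs with h
  · simp [lateralWave, waveNumber, h]
  · have hc : Complex.I * (waveNumber L m : ℂ) ≠ 0 := by
      refine mul_ne_zero Complex.I_ne_zero ?_
      have : waveNumber L m ≠ 0 := by
        unfold waveNumber
        have := Real.pi_pos
        have : (m : ℝ) ≠ 0 := by exact_mod_cast h
        positivity
      exact_mod_cast this
    have h1 := lateralWave_add_period hL m 0
    simp only [lateralWave, zero_add] at h1 ⊢
    rw [integral_exp_mul_complex hc, h1, sub_self, zero_div]

theorem integral_cos_plate {a : ℝ} (ha : 0 < a) (k : ℤ) :
    ∫ t in (0 : ℝ)..a, Real.cos (Real.pi * k / a * t) = if k = 0 then a else 0 := by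
  split_ifs with h
  · simp [h]
  · have hc : Real.pi * k / a ≠ 0 := by
      have := Real.pi_pos
      have : (k : ℝ) ≠ 0 := by exact_mod_cast h
      positivity
    rw [intervalIntegral.integral_comp_mul_left _ hc, integral_cos, mul_zero, Real.sin_zero,
      div_mul_cancel₀ _ ha.ne', mul_comm Real.pi, Real.sin_int_mul_pi]
    simp

theorem integral_plateSin_mul {a : ℝ} (ha : 0 < a) (n k : ℕ) :
    ∫ t in Ioo 0 a, plateSin a n t * plateSin a k t
      = if n = k then (if n = 0 then 0 else (a : ℂ) / 2) else 0 := by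
  have e : ∀ t, plateSin a n t * plateSin a k t = (((Real.cos (Real.pi * ((n - k : ℤ) : ℝ) / a * t)
      - Real.cos (Real.pi * ((n + k : ℤ) : ℝ) / a * t)) / 2 : ℝ) : ℂ) := by
    intro t
    have h1 : Real.pi * ((n - k : ℤ) : ℝ) / a * t = nu a n * t - nu a k * t := by
      unfold nu; push_cast; ring
    have h2 : Real.pi * ((n + k : ℤ) : ℝ) / a * t = nu a n * t + nu a k * t := by
      unfold nu; push_cast; ring
    rw [h1, h2, Real.cos_sub, Real.cos_add, plateSin, plateSin]
    push_cast
    ring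
  have hi : ∀ j : ℤ, IntervalIntegrable (fun t => Real.cos (Real.pi * j / a * t)) volume 0 a :=
    fun j => (by fun_prop : Continuous fun t => Real.cos (Real.pi * j / a * t)).intervalIntegrable _ _
  simp only [e]
  rw [← integral_Ioc_eq_integral_Ioo, ← intervalIntegral.integral_of_le ha.le,
    intervalIntegral.integral_ofReal, intervalIntegral.integral_div,
    intervalIntegral.integral_sub (hi _) (hi _), integral_cos_plate ha, integral_cos_plate ha]
  have c1 : ((n : ℤ) - k = 0) ↔ n = k := by omega
  have c2 : ((n : ℤ) + k = 0) ↔ n = 0 ∧ k = 0 := by omega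
  simp only [c1, c2]
  rcases eq_or_ne n k with rfl | h
  · by_cases hn : n = 0 <;> simp [hn]
  · have : ¬ (n = 0 ∧ k = 0) := by omega
    simp [h, this]

theorem integral_plateCos_mul {a : ℝ} (ha : 0 < a) (n k : ℕ) :
    ∫ t in Ioo 0 a, plateCos a n t * plateCos a k t
      = if n = k then (if n = 0 then (a : ℂ) else (a : ℂ) / 2) else 0 := by
  have e : ∀ t, plateCos a n t * plateCos a k t = (((Real.cos (Real.pi * ((n - k : ℤ) : ℝ) / a * t)
      + Real.cos (Real.pi * ((n + k : ℤ) : ℝ) / a * t)) / 2 : ℝ) : ℂ) := by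
    intro t
    have h1 : Real.pi * ((n - k : ℤ) : ℝ) / a * t = nu a n * t - nu a k * t := by
      unfold nu; push_cast; ring
    have h2 : Real.pi * ((n + k : ℤ) : ℝ) / a * t = nu a n * t + nu a k * t := by
      unfold nu; push_cast; ring
    rw [h1, h2, Real.cos_sub, Real.cos_add, plateCos, plateCos]
    push_cast
    ring
  have hi : ∀ j : ℤ, IntervalIntegrable (fun t => Real.cos (Real.pi * j / a * t)) volume 0 a :=
    fun j => (by fun_prop : Continuous fun t => Real.cos (Real.pi * j / a * t)).intervalIntegrable _ _
  simp only [e]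
  rw [← integral_Ioc_eq_integral_Ioo, ← intervalIntegral.integral_of_le ha.le,
    intervalIntegral.integral_ofReal, intervalIntegral.integral_div,
    intervalIntegral.integral_add (hi _) (hi _), integral_cos_plate ha, integral_cos_plate ha]
  have c1 : ((n : ℤ) - k = 0) ↔ n = k := by omega
  have c2 : ((n : ℤ) + k = 0) ↔ n = 0 ∧ k = 0 := by omega
  simp only [c1, c2]
  rcases eq_or_ne n k with rfl | h
  · by_cases hn : n = 0 <;> simp [hn]
  · have : ¬ (n = 0 ∧ k = 0) := by omega
    simp [h, this]

/-- Conjugation reverses the lateral index and `Z` is real, so the lateral integrals are those of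
the waves with index `k - m`, which vanish unless `m = k`. -/
theorem integral_conj_lateral_mul {L : ℝ} (hL : 0 < L) (a : ℝ) (m k : ℤ × ℤ) {Z W : ℝ → ℂ}
    (hZ : ∀ t, (starRingEnd ℂ) (Z t) = Z t) :
    ∫ x in slab L a, (starRingEnd ℂ) (separated (lateralWave L m.1) (lateralWave L m.2) Z x)
        * separated (lateralWave L k.1) (lateralWave L k.2) W x
      = if m = k then (L : ℂ) ^ 2 * ∫ t in Ioo 0 a, Z t * W t else 0 := by
  have e : ∀ x, (starRingEnd ℂ) (separated (lateralWave L m.1) (lateralWave L m.2) Z x)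
        * separated (lateralWave L k.1) (lateralWave L k.2) W x
      = separated (lateralWave L (-m.1 + k.1)) (lateralWave L (-m.2 + k.2))
        (fun t => Z t * W t) x := by
    intro x
    simp only [separated, map_mul, conj_lateralWave, hZ, ← lateralWave_mul]
    ring
  simp only [e]
  rw [integral_separated, integral_lateralWave hL, integral_lateralWave hL]
  have c : ∀ i j : ℤ, -i + j = 0 ↔ i = j := by omega
  simp only [c, Prod.ext_iff]
  by_cases h1 : m.1 = k.1 <;> by_cases h2 : m.2 = k.2 <;> simp [h1, h2, sq]

/-- The squared norm of `sin (ν_n z)` on `(0, a)`. -/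
def sinWeight (a : ℝ) (n : ℕ) : ℂ := if n = 0 then 0 else a / 2

/-- The squared norm of `cos (ν_n z)` on `(0, a)`. -/
def cosWeight (a : ℝ) (n : ℕ) : ℂ := if n = 0 then a else a / 2

/-- The scalar orthogonality relations decouple different indices. For equal indices the form is
diagonal in the polarization, but the weights differ at `n = 0`: the tangential weight is zero there
and the normal weight is doubled. -/
theorem inner_electricField_electricField {L a : ℝ} (hL : 0 < L) (ha : 0 < a) (m k : ℤ × ℤ)
    (n l : ℕ) (u v : Vec) :
    ⟪electricField hL a m n u, electricField hL a k l v⟫_ℂ = if m = k ∧ n = l then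
      (L : ℂ) ^ 2 * (((starRingEnd ℂ) (u 0) * v 0 + (starRingEnd ℂ) (u 1) * v 1) * sinWeight a n
        + (starRingEnd ℂ) (u 2) * v 2 * cosWeight a n) else 0 := by
  have hS : ∫ x in slab L a, (starRingEnd ℂ) (sinMode L a m n x) * sinMode L a k l x
      = if m = k ∧ n = l then (L : ℂ) ^ 2 * sinWeight a n else 0 := by
    unfold sinMode
    rw [integral_conj_lateral_mul hL a m k (Z := plateSin a n) (fun t => Complex.conj_ofReal _),
      integral_plateSin_mul ha]
    by_cases h1 : m = k <;> by_cases h2 : n = l <;> simp [h1, h2, sinWeight]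
  have hC : ∫ x in slab L a, (starRingEnd ℂ) (cosMode L a m n x) * cosMode L a k l x
      = if m = k ∧ n = l then (L : ℂ) ^ 2 * cosWeight a n else 0 := by
    unfold cosMode
    rw [integral_conj_lateral_mul hL a m k (Z := plateCos a n) (fun t => Complex.conj_ofReal _),
      integral_plateCos_mul ha]
    by_cases h1 : m = k <;> by_cases h2 : n = l <;> simp [h1, h2, cosWeight]
  have iS : Integrable (fun x => (starRingEnd ℂ) (sinMode L a m n x) * sinMode L a k l x)
      (volume.restrict (slab L a)) := integrableOn_slab
    ((Complex.continuous_conj.comp (isSmoothPeriodic_sinMode hL a m n).contDiff.continuous).mul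
      (isSmoothPeriodic_sinMode hL a k l).contDiff.continuous)
  have iC : Integrable (fun x => (starRingEnd ℂ) (cosMode L a m n x) * cosMode L a k l x)
      (volume.restrict (slab L a)) := integrableOn_slab
    ((Complex.continuous_conj.comp (isSmoothPeriodic_cosMode hL a m n).contDiff.continuous).mul
      (isSmoothPeriodic_cosMode hL a k l).contDiff.continuous)
  have e : ⟪electricField hL a m n u, electricField hL a k l v⟫_ℂ
      = ∫ x in slab L a, (((starRingEnd ℂ) (u 0) * v 0 + (starRingEnd ℂ) (u 1) * v 1)
          * ((starRingEnd ℂ) (sinMode L a m n x) * sinMode L a k l x)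
        + (starRingEnd ℂ) (u 2) * v 2
          * ((starRingEnd ℂ) (cosMode L a m n x) * cosMode L a k l x)) := by
    rw [inner_electricField]
    refine integral_congr_ae ?_
    filter_upwards [electricField_coeFn hL a k l v] with x hx
    rw [hx, inner_vec]
    simp [electricMode]
    ring
  rw [e, integral_add (iS.const_mul _) (iC.const_mul _), integral_const_mul, integral_const_mul,
    hS, hC]
  split_ifs <;> ring

/-! ### Completeness of the scalar modes -/

open scoped BoundedContinuousFunction

/-- An integrable real function that is orthogonal to a star subalgebra of bounded continuous
functions that separates points vanishes almost everywhere. -/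
theorem ae_eq_zero_of_forall_mem_starSubalgebra {X : Type*} [TopologicalSpace X] [PolishSpace X]
    [MeasurableSpace X] [BorelSpace X] {ν : Measure X} {f : X → ℝ} (hf : Integrable f ν)
    {A : StarSubalgebra ℂ (X →ᵇ ℂ)}
    (hA : (A.map (BoundedContinuousFunction.toContinuousMapStarₐ ℂ)).SeparatesPoints)
    (h : ∀ g ∈ A, ∫ x, (g x : ℂ) * f x ∂ν = 0) : f =ᵐ[ν] 0 := by
  have hm : AEMeasurable (fun x => ENNReal.ofReal (f x)) ν := hf.aemeasurable.ennreal_ofReal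
  have hm' : AEMeasurable (fun x => ENNReal.ofReal (-f x)) ν := hf.neg.aemeasurable.ennreal_ofReal
  have hfin : ∫⁻ x, ENNReal.ofReal (f x) ∂ν ≠ ⊤ := hf.lintegral_lt_top.ne
  have hfin' : ∫⁻ x, ENNReal.ofReal (-f x) ∂ν ≠ ⊤ := hf.neg.lintegral_lt_top.ne
  have := isFiniteMeasure_withDensity hfin
  have := isFiniteMeasure_withDensity hfin'
  -- The positive and negative parts of `f` are densities of two finite measures. The hypothesis
  -- makes them agree on the algebra, and a separating star algebra determines a finite measure on a
  -- Polish space.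
  have key : ν.withDensity (fun x => ENNReal.ofReal (f x))
      = ν.withDensity (fun x => ENNReal.ofReal (-f x)) := by
    refine ext_of_forall_mem_subalgebra_integral_eq_of_polish hA fun g hg => ?_
    rw [integral_withDensity_eq_integral_toReal_smul₀ hm (by simp),
      integral_withDensity_eq_integral_toReal_smul₀ hm' (by simp), ← sub_eq_zero,
      ← integral_sub, ← h g hg]
    · refine integral_congr_ae (Filter.Eventually.of_forall fun x => ?_)
      change (ENNReal.ofReal (f x)).toReal • g x - (ENNReal.ofReal (-f x)).toReal • g x = _
      rw [← sub_smul, ENNReal.toReal_ofReal', ENNReal.toReal_ofReal', Complex.real_smul, mul_comm]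
      congr 2
      rcases le_total 0 (f x) with hx | hx
      · rw [max_eq_left hx, max_eq_right (by linarith), sub_zero]
      · rw [max_eq_right hx, max_eq_left (by linarith)]; ring
    · refine Integrable.smul_bdd (integrable_toReal_of_lintegral_ne_top hm hfin) ‖g‖
        g.continuous.aestronglyMeasurable
        (Filter.Eventually.of_forall fun x => g.norm_coe_le_norm x)
    · refine Integrable.smul_bdd (integrable_toReal_of_lintegral_ne_top hm' hfin') ‖g‖
        g.continuous.aestronglyMeasurable
        (Filter.Eventually.of_forall fun x => g.norm_coe_le_norm x)
  have := (withDensity_eq_iff hm hm' hfin).1 key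
  filter_upwards [this] with x hx
  have h1 := congrArg ENNReal.toReal hx
  rw [ENNReal.toReal_ofReal', ENNReal.toReal_ofReal'] at h1
  rcases le_total 0 (f x) with hx | hx
  · rw [max_eq_left hx, max_eq_right (by linarith)] at h1; exact h1
  · rw [max_eq_right hx, max_eq_left (by linarith)] at h1; simp only [Pi.zero_apply]; linarith

/-- The scalar mode `exp (i k_m · (x, y)) cos (π k z / a)`, for an integer `k`. -/
def cosModeInt (L a : ℝ) (m : ℤ × ℤ) (k : ℤ) : Pt → ℂ :=
  separated (lateralWave L m.1) (lateralWave L m.2) fun t => (Real.cos (Real.pi * k / a * t) : ℝ)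

theorem cosModeInt_eq_cosMode (L a : ℝ) (m : ℤ × ℤ) (k : ℤ) :
    cosModeInt L a m k = cosMode L a m k.natAbs := by
  have : ∀ t, Real.cos (Real.pi * k / a * t) = Real.cos (nu a k.natAbs * t) := by
    intro t
    unfold nu
    rcases Int.natAbs_eq k with h | h
    · rw [h]; simp
    · rw [← Real.cos_neg]
      congr 1
      have : (k : ℝ) = -(k.natAbs : ℝ) := by exact_mod_cast congrArg (Int.cast (R := ℝ)) h
      rw [this]; ring
  unfold cosModeInt cosMode plateCos
  simp only [this]

theorem norm_lateralWave (L : ℝ) (m : ℤ) (t : ℝ) : ‖lateralWave L m t‖ = 1 := by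
  rw [lateralWave, mul_assoc, ← Complex.ofReal_mul, Complex.norm_exp_I_mul_ofReal]

theorem norm_cosModeInt_le (L a : ℝ) (m : ℤ × ℤ) (k : ℤ) (x : Pt) : ‖cosModeInt L a m k x‖ ≤ 1 := by
  simp only [cosModeInt, separated, norm_mul, norm_lateralWave, one_mul, Complex.norm_real]
  exact Real.abs_cos_le_one _

theorem continuous_cosModeInt (L a : ℝ) (m : ℤ × ℤ) (k : ℤ) : Continuous (cosModeInt L a m k) := by
  rw [cosModeInt_eq_cosMode]
  exact (contDiff_separated (contDiff_lateralWave _ _) (contDiff_lateralWave _ _)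
    (contDiff_plateCos _ _)).continuous

/-- The product formula for cosines makes the span of the modes an algebra. The index `k - k'` can
be negative, hence the integer labels. -/
theorem cosModeInt_mul (L a : ℝ) (m m' : ℤ × ℤ) (k k' : ℤ) (x : Pt) :
    cosModeInt L a m k x * cosModeInt L a m' k' x
      = (1 / 2 : ℂ) * (cosModeInt L a (m + m') (k + k') x + cosModeInt L a (m + m') (k - k') x) := by
  have h1 : Real.pi * ((k + k' : ℤ) : ℝ) / a * x 2
      = Real.pi * k / a * x 2 + Real.pi * k' / a * x 2 := by push_cast; ring
  have h2 : Real.pi * ((k - k' : ℤ) : ℝ) / a * x 2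
      = Real.pi * k / a * x 2 - Real.pi * k' / a * x 2 := by push_cast; ring
  simp only [cosModeInt, separated, Prod.fst_add, Prod.snd_add, ← lateralWave_mul, h1, h2,
    Real.cos_add, Real.cos_sub]
  push_cast
  ring

theorem conj_cosModeInt (L a : ℝ) (m : ℤ × ℤ) (k : ℤ) (x : Pt) :
    (starRingEnd ℂ) (cosModeInt L a m k x) = cosModeInt L a (-m) k x := by
  simp only [cosModeInt, separated, map_mul, conj_lateralWave, Complex.conj_ofReal, Prod.fst_neg,
    Prod.snd_neg]

/-- The cosine modes, as bounded continuous functions on the open slab. -/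
def cosModeBCF (L a : ℝ) (i : (ℤ × ℤ) × ℤ) : slab L a →ᵇ ℂ :=
  BoundedContinuousFunction.ofNormedAddCommGroup (fun x : slab L a => cosModeInt L a i.1 i.2 x)
    ((continuous_cosModeInt L a i.1 i.2).comp continuous_subtype_val) 1
    fun x => norm_cosModeInt_le L a i.1 i.2 x

theorem span_cosModeBCF_mul_le (L a : ℝ) :
    Submodule.span ℂ (range (cosModeBCF L a)) * Submodule.span ℂ (range (cosModeBCF L a))
      ≤ Submodule.span ℂ (range (cosModeBCF L a)) := by
  rw [Submodule.span_mul_span, Submodule.span_le]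
  rintro _ ⟨_, ⟨i, rfl⟩, _, ⟨j, rfl⟩, rfl⟩
  have : cosModeBCF L a i * cosModeBCF L a j = (1 / 2 : ℂ) •
      (cosModeBCF L a (i.1 + j.1, i.2 + j.2) + cosModeBCF L a (i.1 + j.1, i.2 - j.2)) := by
    ext x
    exact cosModeInt_mul L a i.1 j.1 i.2 j.2 x
  change cosModeBCF L a i * cosModeBCF L a j ∈ _
  rw [this]
  exact Submodule.smul_mem _ _ (Submodule.add_mem _ (Submodule.subset_span ⟨_, rfl⟩)
    (Submodule.subset_span ⟨_, rfl⟩))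

/-- The star algebra of the finite linear combinations of cosine modes. -/
def cosAlgebra (L a : ℝ) : StarSubalgebra ℂ (slab L a →ᵇ ℂ) where
  toSubalgebra := (Submodule.span ℂ (range (cosModeBCF L a))).toSubalgebra
    (by
      have : (1 : slab L a →ᵇ ℂ) = cosModeBCF L a 0 := by
        ext x
        simp [cosModeBCF, cosModeInt, separated, lateralWave, waveNumber]
      rw [this]
      exact Submodule.subset_span ⟨_, rfl⟩)
    (fun x y hx hy => span_cosModeBCF_mul_le L a (Submodule.mul_mem_mul hx hy))
  star_mem' := by
    intro g hg
    change g ∈ Submodule.span ℂ (range (cosModeBCF L a)) at hg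
    change star g ∈ Submodule.span ℂ (range (cosModeBCF L a))
    induction hg using Submodule.span_induction with
    | mem g hg =>
      obtain ⟨i, rfl⟩ := hg
      have : star (cosModeBCF L a i) = cosModeBCF L a (-i.1, i.2) := by
        ext x
        exact conj_cosModeInt L a i.1 i.2 x
      rw [this]
      exact Submodule.subset_span ⟨_, rfl⟩
    | zero => rw [star_zero]; exact Submodule.zero_mem _
    | add x y _ _ hx hy => rw [star_add]; exact Submodule.add_mem _ hx hy
    | smul c x _ hx => rw [star_smul]; exact Submodule.smul_mem _ _ hx

/-- Equal values force `s - t` to be an integer multiple of `L`, while both points lie in an open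
interval of length `L`. -/
theorem lateralWave_one_injOn {L : ℝ} (hL : 0 < L) : InjOn (lateralWave L 1) (Ioo 0 L) := by
  intro s hs t ht h
  obtain ⟨n, hn⟩ := Complex.exp_eq_exp_iff_exists_int.1 h
  have hL' : (L : ℂ) ≠ 0 := by exact_mod_cast hL.ne'
  have hpi : (2 * Real.pi * Complex.I : ℂ) ≠ 0 := Complex.two_pi_I_ne_zero
  have h1 : (s : ℂ) = t + n * L := by
    unfold waveNumber at hn
    push_cast at hn
    field_simp at hn
    linear_combination hn
  have h2 : s = t + n * L := by exact_mod_cast h1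
  have a1 : (n : ℝ) < 1 := by by_contra! hc; nlinarith [hs.2, ht.1]
  have a2 : (-1 : ℝ) < n := by by_contra! hc; nlinarith [hs.1, ht.2]
  have a1' : n < 1 := by exact_mod_cast a1
  have a2' : -1 < n := by exact_mod_cast a2
  have : n = 0 := by omega
  simpa [this] using h2

/-- Three modes recover the coordinates: the first lateral wave in `x`, that in `y`, and `cos (π z /
a)`, which is injective because `π z / a` stays in `[0, π]`. -/
theorem separatesPoints_cosAlgebra {L a : ℝ} (hL : 0 < L) (ha : 0 < a) :
    ((cosAlgebra L a).map (BoundedContinuousFunction.toContinuousMapStarₐ ℂ)).SeparatesPoints := by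
  intro x y hxy
  by_contra hcon
  apply hxy
  have h : ∀ m k, cosModeInt L a m k x = cosModeInt L a m k y := by
    intro m k
    by_contra hne
    refine hcon ⟨_, ⟨_, ⟨cosModeBCF L a (m, k), Submodule.subset_span ⟨_, rfl⟩, rfl⟩, rfl⟩, hne⟩
  have h0 := h (1, 0) 0
  have h1 := h (0, 1) 0
  have h2 := h (0, 0) 1
  have e0 : ∀ t, lateralWave L 0 t = 1 := fun t => by simp [lateralWave, waveNumber]
  simp only [cosModeInt, separated, e0, one_mul, mul_one, Int.cast_zero, mul_zero, zero_div,
    zero_mul, Real.cos_zero, Complex.ofReal_one, Complex.ofReal_inj, Int.cast_one] at h0 h1 h2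
  have hx := x.2
  have hy := y.2
  have i0 := lateralWave_one_injOn hL (hx 0 (mem_univ _)) (hy 0 (mem_univ _)) h0
  have i1 := lateralWave_one_injOn hL (hx 1 (mem_univ _)) (hy 1 (mem_univ _)) h1
  have hmem : ∀ w ∈ slab L a, Real.pi / a * w 2 ∈ Icc 0 Real.pi := by
    intro w hw
    have hw2 : 0 < w 2 ∧ w 2 < a := hw 2 (mem_univ _)
    have hpi := Real.pi_pos
    refine ⟨by have := hw2.1; positivity, ?_⟩
    rw [div_mul_eq_mul_div, div_le_iff₀ ha]
    exact mul_le_mul_of_nonneg_left hw2.2.le hpi.le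
  have i2 := Real.injOn_cos (hmem _ hx) (hmem _ hy) h2
  have i2' : (x : Pt) 2 = (y : Pt) 2 :=
    mul_left_cancel₀ (div_ne_zero Real.pi_ne_zero ha.ne') i2
  refine Subtype.ext (funext fun i => ?_)
  fin_cases i
  · exact i0
  · exact i1
  · exact i2'

theorem measurableSet_slab (L a : ℝ) : MeasurableSet (slab L a) :=
  MeasurableSet.univ_pi fun _ => measurableSet_Ioo

theorem isOpen_slab (L a : ℝ) : IsOpen (slab L a) :=
  isOpen_set_pi finite_univ fun _ _ => isOpen_Ioo

/-- The measure argument is run on the open slab as a Polish space of its own. The modes separate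
points there but not in `Pt`, where periodicity identifies points. -/
theorem ae_eq_zero_of_integral_cosMode_real {L a : ℝ} (hL : 0 < L) (ha : 0 < a) {f : Pt → ℝ}
    (hf : Integrable f (volume.restrict (slab L a)))
    (h : ∀ m n, ∫ x in slab L a, cosMode L a m n x * f x = 0) :
    f =ᵐ[volume.restrict (slab L a)] 0 := by
  have : PolishSpace (slab L a) := (isOpen_slab L a).polishSpace
  have hf' : Integrable (fun x : slab L a => f x) (Measure.comap Subtype.val volume) :=
    (integrableOn_iff_comap_subtypeVal (measurableSet_slab L a)).1 hf
  have key := ae_eq_zero_of_forall_mem_starSubalgebra hf' (separatesPoints_cosAlgebra hL ha) ?_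
  · exact (ae_restrict_iff_subtype (measurableSet_slab L a)).2 key
  · intro g hg
    have hint : ∀ g : slab L a →ᵇ ℂ, Integrable (fun x => g x * (f x : ℂ))
        (Measure.comap Subtype.val volume) := fun g =>
      hf'.ofReal.bdd_mul (c := ‖g‖) g.continuous.aestronglyMeasurable
        (Filter.Eventually.of_forall fun x => g.norm_coe_le_norm x)
    change g ∈ Submodule.span ℂ (range (cosModeBCF L a)) at hg
    induction hg using Submodule.span_induction with
    | mem g hg =>
      obtain ⟨i, rfl⟩ := hg
      have := integral_subtype_comap (μ := volume) (measurableSet_slab L a)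
        (fun x : Pt => cosModeInt L a i.1 i.2 x * (f x : ℂ))
      rw [cosModeInt_eq_cosMode, h] at this
      rw [← cosModeInt_eq_cosMode] at this
      exact this
    | zero => simp
    | add x y _ _ hx hy =>
      simp only [BoundedContinuousFunction.coe_add, Pi.add_apply, add_mul]
      rw [integral_add (hint x) (hint y), hx, hy, add_zero]
    | smul c x _ hx =>
      simp only [BoundedContinuousFunction.coe_smul, smul_eq_mul, mul_assoc]
      rw [integral_const_mul, hx, mul_zero]

theorem conj_cosMode (L a : ℝ) (m : ℤ × ℤ) (n : ℕ) (x : Pt) :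
    (starRingEnd ℂ) (cosMode L a m n x) = cosMode L a (-m) n x := by
  have := conj_cosModeInt L a m n x
  simpa only [cosModeInt_eq_cosMode, Int.natAbs_natCast] using this

theorem norm_cosMode_le (L a : ℝ) (m : ℤ × ℤ) (n : ℕ) (x : Pt) : ‖cosMode L a m n x‖ ≤ 1 := by
  have := norm_cosModeInt_le L a m n x
  simpa only [cosModeInt_eq_cosMode, Int.natAbs_natCast] using this

theorem continuous_cosMode (L a : ℝ) (m : ℤ × ℤ) (n : ℕ) : Continuous (cosMode L a m n) :=
  (contDiff_separated (contDiff_lateralWave _ _) (contDiff_lateralWave _ _)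
    (contDiff_plateCos _ _)).continuous

/-- The cosine modes are complete on the slab. -/
theorem ae_eq_zero_of_integral_cosMode {L a : ℝ} (hL : 0 < L) (ha : 0 < a) {f : Pt → ℂ}
    (hf : Integrable f (volume.restrict (slab L a)))
    (h : ∀ m n, ∫ x in slab L a, (starRingEnd ℂ) (cosMode L a m n x) * f x = 0) :
    f =ᵐ[volume.restrict (slab L a)] 0 := by
  have h1 : ∀ m n, ∫ x in slab L a, cosMode L a m n x * f x = 0 := by
    intro m n
    have := h (-m) n
    simpa only [conj_cosMode, neg_neg] using this
  -- The family of modes is stable under conjugation, so the conjugate of `f` is orthogonal to it as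
  -- well, and the real and imaginary parts can be treated separately.
  have h2 : ∀ m n, ∫ x in slab L a, cosMode L a m n x * (starRingEnd ℂ) (f x) = 0 := by
    intro m n
    have := congrArg (starRingEnd ℂ) (h m n)
    rw [← integral_conj] at this
    simpa using this
  have hfc : Integrable (fun x => (starRingEnd ℂ) (f x)) (volume.restrict (slab L a)) :=
    Complex.conjCLE.toContinuousLinearMap.integrable_comp hf
  have hint : ∀ m n, ∀ {g : Pt → ℂ}, Integrable g (volume.restrict (slab L a)) →
      Integrable (fun x => cosMode L a m n x * g x) (volume.restrict (slab L a)) :=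
    fun m n g hg => hg.bdd_mul (c := 1) (continuous_cosMode L a m n).aestronglyMeasurable
      (Filter.Eventually.of_forall fun x => norm_cosMode_le L a m n x)
  have hre := ae_eq_zero_of_integral_cosMode_real hL ha hf.re fun m n => by
    have e : ∀ x, cosMode L a m n x * ((RCLike.re (f x) : ℝ) : ℂ)
        = (1 / 2 : ℂ) * (cosMode L a m n x * f x + cosMode L a m n x * (starRingEnd ℂ) (f x)) := by
      intro x
      have := Complex.re_eq_add_conj (f x)
      change cosMode L a m n x * (((f x).re : ℝ) : ℂ) = _
      rw [this]; ring
    simp only [e]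
    rw [integral_const_mul, integral_add (hint m n hf) (hint m n hfc), h1, h2]
    simp
  have him := ae_eq_zero_of_integral_cosMode_real hL ha hf.im fun m n => by
    have e : ∀ x, cosMode L a m n x * ((RCLike.im (f x) : ℝ) : ℂ)
        = (1 / (2 * Complex.I) : ℂ) *
          (cosMode L a m n x * f x - cosMode L a m n x * (starRingEnd ℂ) (f x)) := by
      intro x
      have := Complex.im_eq_sub_conj (f x)
      change cosMode L a m n x * (((f x).im : ℝ) : ℂ) = _
      rw [this]; ring
    simp only [e]
    rw [integral_const_mul, integral_sub (hint m n hf) (hint m n hfc), h1, h2]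
    simp
  filter_upwards [hre, him] with x hx hy
  exact Complex.ext hx hy

/-- The sine modes are complete on the slab. -/
theorem ae_eq_zero_of_integral_sinMode {L a : ℝ} (hL : 0 < L) (ha : 0 < a) {f : Pt → ℂ}
    (hf : Integrable f (volume.restrict (slab L a)))
    (h : ∀ m n, ∫ x in slab L a, (starRingEnd ℂ) (sinMode L a m n x) * f x = 0) :
    f =ᵐ[volume.restrict (slab L a)] 0 := by
  have hs : Continuous fun x : Pt => plateSin a 1 (x 2) :=
    (contDiff_plateSin a 1).continuous.comp (continuous_apply 2)
  have hb : ∀ (n : ℕ) (t : ℝ), ‖plateSin a n t‖ ≤ 1 := fun n t => by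
    rw [plateSin, Complex.norm_real]; exact Real.abs_sin_le_one _
  have hg : Integrable (fun x : Pt => plateSin a 1 (x 2) * f x) (volume.restrict (slab L a)) :=
    hf.bdd_mul (c := 1) hs.aestronglyMeasurable (Filter.Eventually.of_forall fun x => hb _ _)
  have hint : ∀ m n, Integrable (fun x => (starRingEnd ℂ) (sinMode L a m n x) * f x)
      (volume.restrict (slab L a)) := by
    intro m n
    refine hf.bdd_mul (c := 1) (Complex.continuous_conj.comp
      (isSmoothPeriodic_sinMode hL a m n).contDiff.continuous).aestronglyMeasurable
      (Filter.Eventually.of_forall fun x => ?_)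
    rw [RCLike.norm_conj, sinMode, separated, norm_mul, norm_mul, norm_lateralWave,
      norm_lateralWave, one_mul, one_mul]
    exact hb _ _
  have hsin : ∀ n t, (starRingEnd ℂ) (plateSin a n t) = plateSin a n t :=
    fun n t => Complex.conj_ofReal _
  have hcos : ∀ n t, (starRingEnd ℂ) (plateCos a n t) = plateCos a n t :=
    fun n t => Complex.conj_ofReal _
  -- The cosine result is applied to `sin (π z / a) * f`. The identity `2 cos(ν_{n+1} z) sin(ν_1 z)
  -- = sin(ν_{n+2} z) - sin(ν_n z)` expresses its cosine coefficients through sine coefficients of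
  -- `f`; for the constant cosine the product is the sine mode with index 1.
  have key := ae_eq_zero_of_integral_cosMode hL ha hg fun m n => by
    rcases n with _ | n
    · rw [← h m 1]
      refine integral_congr_ae (Filter.Eventually.of_forall fun x => ?_)
      have : plateCos a 0 (x 2) = 1 := by simp [plateCos, nu]
      simp only [cosMode, sinMode, separated, map_mul, hsin, this, map_one]
      ring
    · have e : ∀ x : Pt, (starRingEnd ℂ) (cosMode L a m (n + 1) x) * (plateSin a 1 (x 2) * f x)
          = (1 / 2 : ℂ) * ((starRingEnd ℂ) (sinMode L a m (n + 2) x) * f x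
            - (starRingEnd ℂ) (sinMode L a m n x) * f x) := by
        intro x
        have t : plateSin a (n + 2) (x 2) - plateSin a n (x 2)
            = 2 * (plateCos a (n + 1) (x 2) * plateSin a 1 (x 2)) := by
          have h1' : nu a ((n + 2 : ℕ)) * x 2 = nu a ((n + 1 : ℕ)) * x 2 + nu a ((1 : ℕ)) * x 2 := by
            unfold nu; push_cast; ring
          have h2' : nu a n * x 2 = nu a ((n + 1 : ℕ)) * x 2 - nu a ((1 : ℕ)) * x 2 := by
            unfold nu; push_cast; ring
          rw [plateSin, plateSin, plateCos, plateSin, h1', h2', Real.sin_add, Real.sin_sub]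
          push_cast
          ring
        simp only [cosMode, sinMode, separated, map_mul, hsin, hcos]
        linear_combination (-(1 / 2 : ℂ) * (starRingEnd ℂ) (lateralWave L m.1 (x 0))
          * (starRingEnd ℂ) (lateralWave L m.2 (x 1)) * f x) * t
      simp only [e]
      rw [integral_const_mul, integral_sub (hint _ _) (hint _ _), h, h]
      simp
  filter_upwards [key, ae_restrict_mem (measurableSet_slab L a)] with x hx hxs
  -- The auxiliary factor `sin (π z / a)` is strictly positive inside the slab and can be divided
  -- out.
  refine (mul_eq_zero.1 hx).resolve_left ?_
  have hx2 : 0 < x 2 ∧ x 2 < a := hxs 2 (mem_univ _)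
  have hpos : 0 < Real.sin (nu a 1 * x 2) := by
    have hpi := Real.pi_pos
    refine Real.sin_pos_of_pos_of_lt_pi (mul_pos (by unfold nu; positivity) hx2.1) ?_
    rw [nu, div_mul_eq_mul_div, div_lt_iff₀ ha, Nat.cast_one, mul_one]
    exact mul_lt_mul_of_pos_left hx2.2 hpi
  rw [plateSin]
  exact_mod_cast hpos.ne'

/-! ### Cutoffs near the plates and orthogonality to gradients -/

/-- A smooth step that vanishes for `t ≤ 1` and equals `1` for `t ≥ 2`. -/
def smoothStep (t : ℝ) : ℝ := Real.smoothTransition (t - 1)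

theorem contDiff_smoothStep : ContDiff ℝ ∞ smoothStep :=
  Real.smoothTransition.contDiff.comp (contDiff_id.sub contDiff_const)

theorem smoothStep_of_le {t : ℝ} (ht : t ≤ 1) : smoothStep t = 0 :=
  Real.smoothTransition.zero_of_nonpos (by linarith)

theorem smoothStep_of_ge {t : ℝ} (ht : 2 ≤ t) : smoothStep t = 1 :=
  Real.smoothTransition.one_of_one_le (by linarith)

theorem abs_smoothStep_le (t : ℝ) : |smoothStep t| ≤ 1 := by
  rw [smoothStep, abs_of_nonneg (Real.smoothTransition.nonneg _)]
  exact Real.smoothTransition.le_one _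

theorem deriv_smoothStep_of_lt {t : ℝ} (ht : t < 1) : deriv smoothStep t = 0 := by
  have : smoothStep =ᶠ[nhds t] fun _ => 0 := by
    filter_upwards [Iio_mem_nhds ht] with s hs using smoothStep_of_le (le_of_lt hs)
  rw [this.deriv_eq, deriv_const]

theorem deriv_smoothStep_of_gt {t : ℝ} (ht : 2 < t) : deriv smoothStep t = 0 := by
  have : smoothStep =ᶠ[nhds t] fun _ => 1 := by
    filter_upwards [Ioi_mem_nhds ht] with s hs using smoothStep_of_ge (le_of_lt hs)
  rw [this.deriv_eq, deriv_const]

theorem hasDerivAt_smoothStep (t : ℝ) : HasDerivAt smoothStep (deriv smoothStep t) t :=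
  (contDiff_smoothStep.differentiable (by simp) t).hasDerivAt

/-- The derivative lives on `[1, 2]`. The weight `|t|` makes the bound scale invariant, so it
survives the rescaling `t ↦ j t` uniformly in `j`. -/
theorem exists_abs_mul_deriv_smoothStep_le : ∃ M, 0 ≤ M ∧ ∀ t, |t| * |deriv smoothStep t| ≤ M := by
  have hc : Continuous fun t => t * deriv smoothStep t :=
    continuous_id.mul (contDiff_smoothStep.continuous_deriv (by simp))
  obtain ⟨M, hM⟩ := (isCompact_Icc (a := (0 : ℝ)) (b := 3)).exists_bound_of_continuousOn
    hc.continuousOn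
  refine ⟨max M 0, le_max_right _ _, fun t => ?_⟩
  by_cases h : t ∈ Icc (0 : ℝ) 3
  · rw [← abs_mul]
    exact (hM t h).trans (le_max_left _ _)
  · have : deriv smoothStep t = 0 := by
      by_cases h0 : 0 ≤ t
      · exact deriv_smoothStep_of_gt (by by_contra! h1; exact h ⟨h0, by linarith⟩)
      · exact deriv_smoothStep_of_lt (by linarith)
    simp [this]

/-- The function `sin (ν_n t)`, cut off near the plates at distance of order `1 / j`. -/
def cutSin (a : ℝ) (n j : ℕ) (t : ℝ) : ℝ :=
  Real.sin (nu a n * t) * (smoothStep (j * t) * smoothStep (j * (a - t)))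

/-- The derivative of `cutSin`. -/
def cutSinDeriv (a : ℝ) (n j : ℕ) (t : ℝ) : ℝ :=
  nu a n * Real.cos (nu a n * t) * (smoothStep (j * t) * smoothStep (j * (a - t)))
    + Real.sin (nu a n * t) * (j * deriv smoothStep (j * t) * smoothStep (j * (a - t))
      - smoothStep (j * t) * (j * deriv smoothStep (j * (a - t))))

theorem hasDerivAt_cutSin (a : ℝ) (n j : ℕ) (t : ℝ) :
    HasDerivAt (cutSin a n j) (cutSinDeriv a n j t) t := by
  have h1 := ((hasDerivAt_id t).const_mul (nu a n)).sin
  have h2 := (hasDerivAt_smoothStep (j * t)).comp t ((hasDerivAt_id t).const_mul (j : ℝ))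
  have h3 := (hasDerivAt_smoothStep (j * (a - t))).comp t
    (((hasDerivAt_id t).const_sub a).const_mul (j : ℝ))
  convert! h1.mul (h2.mul h3) using 1
  simp [cutSinDeriv]
  ring

theorem contDiff_cutSin (a : ℝ) (n j : ℕ) : ContDiff ℝ ∞ (cutSin a n j) :=
  (contDiff_const.mul contDiff_id).sin.mul
    ((contDiff_smoothStep.comp (contDiff_const.mul contDiff_id)).mul
      (contDiff_smoothStep.comp (contDiff_const.mul (contDiff_const.sub contDiff_id))))

theorem abs_cutSin_le (a : ℝ) (n j : ℕ) (t : ℝ) : |cutSin a n j t| ≤ 1 := by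
  rw [cutSin, abs_mul, abs_mul]
  exact mul_le_one₀ (Real.abs_sin_le_one _) (by positivity)
    (mul_le_one₀ (abs_smoothStep_le _) (abs_nonneg _) (abs_smoothStep_le _))

theorem nu_nonneg {a : ℝ} (ha : 0 < a) (n : ℕ) : 0 ≤ nu a n := by
  have := Real.pi_pos
  unfold nu
  positivity

theorem abs_sin_nu_mul_le {a : ℝ} (ha : 0 < a) (n : ℕ) (t : ℝ) :
    |Real.sin (nu a n * t)| ≤ nu a n * |t| := by
  refine Real.abs_sin_le_abs.trans_eq ?_
  rw [abs_mul, abs_of_nonneg (nu_nonneg ha n)]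

theorem abs_sin_nu_mul_le' {a : ℝ} (ha : 0 < a) (n : ℕ) (t : ℝ) :
    |Real.sin (nu a n * t)| ≤ nu a n * |a - t| := by
  have h : nu a n * t = n * Real.pi - nu a n * (a - t) := by
    unfold nu
    field_simp
    ring
  rw [h, Real.sin_nat_mul_pi_sub, abs_neg, abs_mul, abs_pow, abs_neg, abs_one, one_pow, one_mul]
  exact abs_sin_nu_mul_le ha n _

/-- The constant must not depend on `j`, although differentiating the cutoff costs a factor `j`. The
sine vanishes linearly at both plates, and its factor `|t|` or `|a - t|` compensates exactly. -/
theorem exists_abs_cutSinDeriv_le {a : ℝ} (ha : 0 < a) (n : ℕ) :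
    ∃ C, ∀ j t, |cutSinDeriv a n j t| ≤ C := by
  obtain ⟨M, hM0, hM⟩ := exists_abs_mul_deriv_smoothStep_le
  have hν := nu_nonneg ha n
  refine ⟨nu a n + (nu a n * M + nu a n * M), fun j t => ?_⟩
  have b1 : |nu a n * Real.cos (nu a n * t) * (smoothStep (j * t) * smoothStep (j * (a - t)))|
      ≤ nu a n := by
    rw [abs_mul, abs_mul, abs_mul, abs_of_nonneg hν, mul_assoc]
    refine mul_le_of_le_one_right hν (mul_le_one₀ (Real.abs_cos_le_one _) (by positivity)
      (mul_le_one₀ (abs_smoothStep_le _) (abs_nonneg _) (abs_smoothStep_le _)))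
  have aux : ∀ s σ : ℝ, |Real.sin (nu a n * t)| ≤ nu a n * |s| → |σ| ≤ 1 →
      |Real.sin (nu a n * t)| * (|(j : ℝ) * deriv smoothStep (j * s)| * |σ|) ≤ nu a n * M := by
    intro s σ hs hσ
    calc |Real.sin (nu a n * t)| * (|(j : ℝ) * deriv smoothStep (j * s)| * |σ|)
        ≤ (nu a n * |s|) * (|(j : ℝ) * deriv smoothStep (j * s)| * 1) := by gcongr
      _ = nu a n * (|(j : ℝ) * s| * |deriv smoothStep (j * s)|) := by
          rw [abs_mul, abs_mul]; ring
      _ ≤ nu a n * M := mul_le_mul_of_nonneg_left (hM _) hν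
  have b2 := aux t (smoothStep (j * (a - t))) (abs_sin_nu_mul_le ha n t) (abs_smoothStep_le _)
  have b3 := aux (a - t) (smoothStep (j * t)) (abs_sin_nu_mul_le' ha n t) (abs_smoothStep_le _)
  rw [cutSinDeriv]
  refine (abs_add_le _ _).trans (add_le_add b1 ?_)
  rw [abs_mul]
  refine (mul_le_mul_of_nonneg_left (abs_sub _ _) (abs_nonneg _)).trans ?_
  rw [mul_add]
  refine add_le_add ?_ ?_
  · rw [abs_mul (_ * _)]; exact b2
  · rw [abs_mul, mul_comm |smoothStep _|]; exact b3

theorem eventually_cutSin_eq {a : ℝ} (n : ℕ) {t : ℝ} (h0 : 0 < t) (h1 : t < a) :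
    ∀ᶠ j : ℕ in Filter.atTop, cutSin a n j t = Real.sin (nu a n * t) ∧
      cutSinDeriv a n j t = nu a n * Real.cos (nu a n * t) := by
  have hs : ∀ s : ℝ, 0 < s → ∀ᶠ j : ℕ in Filter.atTop, 2 < j * s := fun s hs =>
    (tendsto_natCast_atTop_atTop.atTop_mul_const hs).eventually_gt_atTop 2
  filter_upwards [hs t h0, hs (a - t) (sub_pos.2 h1)] with j hj hj'
  simp [cutSin, cutSinDeriv, smoothStep_of_ge hj.le, smoothStep_of_ge hj'.le,
    deriv_smoothStep_of_gt hj, deriv_smoothStep_of_gt hj']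

/-- The test function that approximates `sinMode`. -/
def cutMode (L a : ℝ) (m : ℤ × ℤ) (n j : ℕ) : Pt → ℂ :=
  separated (lateralWave L m.1) (lateralWave L m.2) fun t => (cutSin a n j t : ℝ)

theorem isSmoothPeriodic_cutMode {L : ℝ} (hL : 0 < L) (a : ℝ) (m : ℤ × ℤ) (n j : ℕ) :
    IsSmoothPeriodic L (cutMode L a m n j) :=
  isSmoothPeriodic_separated hL m (Complex.ofRealCLM.contDiff.comp (contDiff_cutSin a n j))

theorem vanishesNearPlates_cutMode (L a : ℝ) (m : ℤ × ℤ) (n : ℕ) {j : ℕ} (hj : 0 < j) :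
    VanishesNearPlates a (cutMode L a m n j) := by
  have hj' : (0 : ℝ) < j := by exact_mod_cast hj
  refine ⟨1 / j, by positivity, fun x hx => ?_⟩
  have : cutSin a n j (x 2) = 0 := by
    rcases hx with hx | hx
    · rw [lt_div_iff₀ hj', mul_comm] at hx
      simp [cutSin, smoothStep_of_le hx.le]
    · have hx' : a - x 2 < 1 / j := by linarith
      rw [lt_div_iff₀ hj', mul_comm] at hx'
      simp [cutSin, smoothStep_of_le hx'.le]
  simp [cutMode, separated, this]

theorem grad_cutMode (L a : ℝ) (m : ℤ × ℤ) (n j : ℕ) (x : Pt) :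
    grad (cutMode L a m n j) x = (lateralWave L m.1 (x 0) * lateralWave L m.2 (x 1)) •
      !₂[Complex.I * waveNumber L m.1 * cutSin a n j (x 2),
        Complex.I * waveNumber L m.2 * cutSin a n j (x 2), (cutSinDeriv a n j (x 2) : ℂ)] := by
  obtain ⟨h0, h1, h2⟩ := partialDeriv_separated (hasDerivAt_lateralWave L m.1 (x 0))
    (hasDerivAt_lateralWave L m.2 (x 1)) (hasDerivAt_cutSin a n j (x 2)).ofReal_comp
  ext i
  fin_cases i
  · refine h0.trans ?_
    simp; ring
  · refine h1.trans ?_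
    simp; ring
  · refine h2.trans ?_
    simp

theorem electricMode_gradDirection (L a : ℝ) (m : ℤ × ℤ) (n : ℕ) (x : Pt) :
    electricMode L a m n (gradDirection L a m n) x
      = (lateralWave L m.1 (x 0) * lateralWave L m.2 (x 1)) •
      !₂[Complex.I * waveNumber L m.1 * (Real.sin (nu a n * x 2) : ℝ),
        Complex.I * waveNumber L m.2 * (Real.sin (nu a n * x 2) : ℝ),
        ((nu a n * Real.cos (nu a n * x 2) : ℝ) : ℂ)] := by
  ext i
  fin_cases i <;>
    simp [electricMode, gradDirection, sinMode, cosMode, separated, plateSin, plateCos] <;> ring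

/-- Divergence-free fields are orthogonal to the gradients of the sine modes. -/
theorem inner_electricField_gradDirection_eq_zero {L a : ℝ} (hL : 0 < L) (ha : 0 < a)
    (m : ℤ × ℤ) (n : ℕ) {E : L2Field L a} (hE : IsWeaklyDivFree L a E) :
    ⟪electricField hL a m n (gradDirection L a m n), E⟫_ℂ = 0 := by
  rw [inner_electricField]
  -- The sine mode vanishes on the plates but need not vanish near them, so it need not be an
  -- admissible test function. It is replaced by `cutMode`, whose gradients are bounded uniformly in
  -- `j`.
  obtain ⟨C, hC⟩ := exists_abs_cutSinDeriv_le ha n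
  set B : ℝ := |waveNumber L m.1| + |waveNumber L m.2| + C with hB
  have hbound : ∀ j x, ‖grad (cutMode L a m n j) x‖ ≤ B := by
    intro j x
    rw [grad_cutMode, norm_smul, norm_mul, norm_lateralWave, norm_lateralWave, one_mul, one_mul]
    refine (EuclideanSpace.norm_eq _).trans_le ?_
    have hc := hC j (x 2)
    have hs := abs_cutSin_le a n j (x 2)
    have h1 : |waveNumber L m.1| * |cutSin a n j (x 2)| ≤ |waveNumber L m.1| :=
      mul_le_of_le_one_right (abs_nonneg _) hs
    have h2 : |waveNumber L m.2| * |cutSin a n j (x 2)| ≤ |waveNumber L m.2| :=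
      mul_le_of_le_one_right (abs_nonneg _) hs
    have p1 : 0 ≤ |waveNumber L m.1| * |cutSin a n j (x 2)| := by positivity
    have p2 : 0 ≤ |waveNumber L m.2| * |cutSin a n j (x 2)| := by positivity
    have p3 : 0 ≤ |cutSinDeriv a n j (x 2)| := abs_nonneg _
    rw [Fin.sum_univ_three]
    simp only [Matrix.cons_val, norm_mul, Complex.norm_I, one_mul, Complex.norm_real,
      Real.norm_eq_abs]
    refine (Real.sqrt_le_sqrt (y := (|waveNumber L m.1| * |cutSin a n j (x 2)|
      + |waveNumber L m.2| * |cutSin a n j (x 2)| + |cutSinDeriv a n j (x 2)|) ^ 2) ?_).trans ?_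
    · nlinarith [mul_nonneg p1 p2, mul_nonneg p1 p3, mul_nonneg p2 p3]
    · rw [Real.sqrt_sq (by positivity)]
      linarith
  -- At each interior point the cutoff equals 1 for large `j`, so the integrands are eventually
  -- constant in `j`; `B * ‖E x‖` is integrable because the slab has finite measure.
  have hlim := tendsto_integral_of_dominated_convergence (μ := volume.restrict (slab L a))
    (F := fun (j : ℕ) x => ⟪grad (cutMode L a m n j) x, E x⟫_ℂ)
    (f := fun x => ⟪electricMode L a m n (gradDirection L a m n) x, E x⟫_ℂ)
    (bound := fun x => B * ‖E x‖)
    (fun j => (continuous_grad (isSmoothPeriodic_cutMode hL a m n j).contDiff).aestronglyMeasurable.inner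
      (Lp.aestronglyMeasurable E))
    (((Lp.memLp E).integrable one_le_two).norm.const_mul B)
    (fun j => Filter.Eventually.of_forall fun x => (norm_inner_le_norm _ _).trans
      (mul_le_mul_of_nonneg_right (hbound j x) (norm_nonneg _)))
    (by
      filter_upwards [ae_restrict_mem (measurableSet_slab L a)] with x hx
      have hx2 : 0 < x 2 ∧ x 2 < a := hx 2 (mem_univ _)
      refine tendsto_const_nhds.congr' ?_
      filter_upwards [eventually_cutSin_eq n hx2.1 hx2.2] with j hj
      rw [grad_cutMode, electricMode_gradDirection, hj.1, hj.2])
  refine tendsto_nhds_unique hlim (tendsto_const_nhds.congr' ?_)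
  filter_upwards [Filter.eventually_gt_atTop 0] with j hj
  exact (hE _ (isSmoothPeriodic_cutMode hL a m n j) (vanishesNearPlates_cutMode L a m n hj)).symm

/-! ### Polarizations and the Maxwell eigenbasis -/

/-- The complement of a line in `ℂ³` is a plane: these are the two polarizations behind the factor 2
in the trace. The last clause is the form of spanning that completeness uses, where `S` is the
subspace of polarizations whose mode is orthogonal to a given field. -/
theorem exists_polarizations {K : Vec} (hK : K ≠ 0) :
    ∃ u : Fin 2 → Vec, Orthonormal ℂ u ∧ (∀ i, ⟪K, u i⟫_ℂ = 0) ∧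
      ∀ S : Submodule ℂ Vec, K ∈ S → (∀ i, u i ∈ S) → S = ⊤ := by
  have : Fact (Module.finrank ℂ Vec = 2 + 1) := ⟨finrank_euclideanSpace_fin⟩
  have hfin : Module.finrank ℂ (ℂ ∙ K)ᗮ = 2 := Submodule.finrank_orthogonal_span_singleton hK
  let b := (stdOrthonormalBasis ℂ (ℂ ∙ K)ᗮ).reindex (finCongr hfin)
  refine ⟨fun i => (b i : Vec), b.orthonormal.comp_linearIsometry (ℂ ∙ K)ᗮ.subtypeₗᵢ,
    fun i => (b i).2 K (Submodule.mem_span_singleton_self K), fun S hS hb => ?_⟩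
  rw [eq_top_iff, ← Submodule.sup_orthogonal_of_hasOrthogonalProjection (K := ℂ ∙ K)]
  refine sup_le ((Submodule.span_singleton_le_iff_mem _ _).2 hS) fun w hw => ?_
  have := b.sum_repr ⟨w, hw⟩
  have h2 := congrArg (Submodule.subtype _) this
  rw [map_sum] at h2
  change _ = w at h2
  rw [← h2]
  exact Submodule.sum_mem _ fun i _ => Submodule.smul_mem _ _ (hb i)

/-- The unit vector in the direction normal to the plates. -/
def normalVec : Vec := EuclideanSpace.single 2 1

/-- For `n = 0` the tangential components carry a vanishing sine, so the normal polarization is the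
only one with a nonzero mode; transversality is automatic as `ν_0 = 0`. -/
theorem gradDirection_zero_inner_normalVec (L a : ℝ) (m : ℤ × ℤ) :
    ⟪gradDirection L a m 0, normalVec⟫_ℂ = 0 := by
  rw [inner_gradDirection]
  simp [normalVec, nu]

theorem gradDirection_succ_ne_zero (L : ℝ) {a : ℝ} (ha : 0 < a) (m : ℤ × ℤ) (n : ℕ) :
    gradDirection L a m (n + 1) ≠ 0 := by
  intro h
  have h2 := congrArg (fun w : Vec => w 2) h
  have : nu a (n + 1 : ℕ) ≠ 0 := by
    have := Real.pi_pos
    unfold nu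
    positivity
  simp only [gradDirection, Matrix.cons_val, PiLp.zero_apply] at h2
  exact this (by exact_mod_cast h2)

/-- This identifies the one transverse mode absent from `Hphys`, which is why the index `m = 0` is
missing from the second sum. -/
theorem staticMode_eq_smul {L : ℝ} (hL : 0 < L) (a : ℝ) :
    staticMode L a = (((√(L ^ 2 * a))⁻¹ : ℝ) : ℂ) • electricField hL a 0 0 normalVec := by
  refine Lp.ext ?_
  filter_upwards [staticMode_coeFn L a, electricField_coeFn hL a 0 0 normalVec,
    Lp.coeFn_smul (((√(L ^ 2 * a))⁻¹ : ℝ) : ℂ) (electricField hL a 0 0 normalVec)] with x h1 h2 h3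
  rw [h1, h3, Pi.smul_apply, h2]
  ext i
  fin_cases i <;> simp [electricMode, normalVec, cosMode, separated, lateralWave, waveNumber,
    plateCos, nu]

theorem inner_electricField_of_ne {L a : ℝ} (hL : 0 < L) (ha : 0 < a) {m k : ℤ × ℤ}
    {n l : ℕ} (u v : Vec) (h : ¬(m = k ∧ n = l)) :
    ⟪electricField hL a m n u, electricField hL a k l v⟫_ℂ = 0 := by
  rw [inner_electricField_electricField hL ha, if_neg h]

/-- For `n ≥ 1` both weights equal `a / 2`, so the mode map is a multiple of an isometry and
orthonormal polarizations give orthogonal fields. -/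
theorem inner_electricField_succ {L a : ℝ} (hL : 0 < L) (ha : 0 < a) (m : ℤ × ℤ)
    (n : ℕ) (u v : Vec) :
    ⟪electricField hL a m (n + 1) u, electricField hL a m (n + 1) v⟫_ℂ
      = ((L ^ 2 * a / 2 : ℝ) : ℂ) * ⟪u, v⟫_ℂ := by
  rw [inner_electricField_electricField hL ha, if_pos ⟨rfl, rfl⟩, inner_vec, sinWeight, cosWeight,
    if_neg n.succ_ne_zero, if_neg n.succ_ne_zero]
  push_cast
  ring

theorem inner_electricField_zero {L a : ℝ} (hL : 0 < L) (ha : 0 < a) (m : ℤ × ℤ) :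
    ⟪electricField hL a m 0 normalVec, electricField hL a m 0 normalVec⟫_ℂ
      = ((L ^ 2 * a : ℝ) : ℂ) := by
  rw [inner_electricField_electricField hL ha, if_pos ⟨rfl, rfl⟩, cosWeight, if_pos rfl]
  simp [normalVec]

theorem electricField_mem_Hphys {L a : ℝ} (hL : 0 < L) (ha : 0 < a) {m : ℤ × ℤ} {n : ℕ}
    {u : Vec} (hu : ⟪gradDirection L a m n, u⟫_ℂ = 0) (hmn : ¬(m = 0 ∧ n = 0)) :
    electricField hL a m n u ∈ Hphys L a := by
  refine ⟨Submodule.le_topologicalClosure _ ⟨_, electricField_mem_pecGraph hL ha m n hu, rfl⟩, ?_⟩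
  refine Submodule.mem_orthogonal_singleton_iff_inner_right.2 ?_
  rw [staticMode_eq_smul hL, inner_smul_left,
    inner_electricField_of_ne hL ha _ _ fun h => hmn ⟨h.1.symm, h.2.symm⟩, mul_zero]

theorem electricField_mem_maxwellGraph {L a : ℝ} (hL : 0 < L) (ha : 0 < a) {m : ℤ × ℤ} {n : ℕ}
    {u : Vec} (hu : ⟪gradDirection L a m n, u⟫_ℂ = 0) (h : electricField hL a m n u ∈ Hphys L a) :
    ((⟨_, h⟩ : Hphys L a), ((kSq L m + nu a n ^ 2 : ℝ) : ℂ) • (⟨_, h⟩ : Hphys L a))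
      ∈ maxwellGraph L a :=
  ⟨WithLp.toLp 2 (electricField hL a m n u, magneticField hL a m n (curlPolarization L a m n u)),
    ⟨electricField_mem_pecGraph hL ha m n hu, h⟩, rfl,
    fun _ hq => inner_magneticField_curl hL ha m n hu hq.1⟩

/-- The weak divergence condition involves no derivative of the field, hence is closed in `L²` and
survives the closure defining `HPEC`. -/
theorem isWeaklyDivFree_of_mem_HPEC {L a : ℝ} {G : L2Field L a} (hG : G ∈ HPEC L a) :
    IsWeaklyDivFree L a G := by
  have hcl : IsClosed {E : L2Field L a | IsWeaklyDivFree L a E} := by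
    simp only [IsWeaklyDivFree, ofPred_forall]
    refine isClosed_iInter fun φ => isClosed_iInter fun hφ => isClosed_iInter fun _ => ?_
    simp only [integral_inner_eq L a (continuous_grad hφ.contDiff)]
    exact isClosed_eq (continuous_const.inner continuous_id) continuous_const
  refine closure_minimal ?_ hcl hG
  rintro _ ⟨p, hp, rfl⟩
  exact hp.2.2

theorem integrable_coord {L a : ℝ} (G : L2Field L a) (j : Fin 3) :
    Integrable (fun x => G x j) (volume.restrict (slab L a)) :=
  (EuclideanSpace.proj (𝕜 := ℂ) j).integrable_comp ((Lp.memLp G).integrable one_le_two)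

/-- The electric modes with arbitrary polarizations are complete in `L²`. -/
theorem eq_zero_of_inner_electricField {L a : ℝ} (hL : 0 < L) (ha : 0 < a) {G : L2Field L a}
    (hsucc : ∀ m n u, ⟪electricField hL a m (n + 1) u, G⟫_ℂ = 0)
    (hzero : ∀ m, ⟪electricField hL a m 0 normalVec, G⟫_ℂ = 0) : G = 0 := by
  have hsin : ∀ m n x, n = 0 → sinMode L a m n x = 0 := by
    rintro m n x rfl
    simp [sinMode, separated, plateSin, nu]
  -- Tangential components are tested by sine modes and the normal one by cosine modes; a tangential
  -- test at `n = 0` is vacuous because its sine is zero.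
  have h01 : ∀ j : Fin 3, j ≠ 2 → (fun x => G x j) =ᵐ[volume.restrict (slab L a)] 0 := by
    intro j hj
    refine ae_eq_zero_of_integral_sinMode hL ha (integrable_coord G j) fun m n => ?_
    rcases n with _ | n
    · simp [hsin m 0 _ rfl]
    · rw [← hsucc m n (EuclideanSpace.single j 1), inner_electricField]
      refine integral_congr_ae (Filter.Eventually.of_forall fun x => ?_)
      simp only [inner_vec, electricMode]
      fin_cases j
      · simp
      · simp
      · exact absurd rfl hj
  have h2 : (fun x => G x 2) =ᵐ[volume.restrict (slab L a)] 0 := by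
    refine ae_eq_zero_of_integral_cosMode hL ha (integrable_coord G 2) fun m n => ?_
    have : ⟪electricField hL a m n normalVec, G⟫_ℂ = 0 := by
      rcases n with _ | n
      · exact hzero m
      · exact hsucc m n _
    rw [← this, inner_electricField]
    refine integral_congr_ae (Filter.Eventually.of_forall fun x => ?_)
    simp only [inner_vec, electricMode, normalVec]
    simp
  refine Lp.eq_zero_iff_ae_eq_zero.2 ?_
  filter_upwards [h01 0 (by decide), h01 1 (by decide), h2] with x h0 h1 h2
  ext i
  fin_cases i
  · exact h0
  · exact h1
  · exact h2

/-- The labels of the modes: lateral index, plate index `n + 1` and polarization, or a nonzero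
lateral index. -/
abbrev ModeIndex : Type := ((ℤ × ℤ) × ℕ) × Fin 2 ⊕ {m : ℤ × ℤ // m ≠ 0}

/-- The eigenvalues of the Maxwell operator, with multiplicity. -/
def maxwellEigenvalue (L a : ℝ) : ModeIndex → ℝ :=
  Sum.elim (fun k => kSq L k.1.1 + nu a (k.1.2 + 1) ^ 2) fun m => kSq L m

theorem maxwellEigenvalue_nonneg (L a : ℝ) (k : ModeIndex) : 0 ≤ maxwellEigenvalue L a k := by
  rcases k with k | m
  · exact add_nonneg (kSq_nonneg _ _) (sq_nonneg _)
  · exact kSq_nonneg _ _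

/-- The Maxwell operator has an orthonormal basis of eigenvectors. -/
theorem exists_maxwell_eigenbasis {L a : ℝ} (hL : 0 < L) (ha : 0 < a) :
    ∃ v : HilbertBasis ModeIndex ℂ (Hphys L a), ∀ k,
      (v k, (maxwellEigenvalue L a k : ℂ) • v k) ∈ maxwellGraph L a := by
  choose u hu1 hu2 hu3 using fun (m : ℤ × ℤ) (n : ℕ) =>
    exists_polarizations (gradDirection_succ_ne_zero L ha m n)
  have hV : 0 < L ^ 2 * a := by positivity
  -- `c` and `d` are the inverse norms of the modes with `n ≥ 1` and with `n = 0`.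
  set c : ℝ := (√(L ^ 2 * a / 2))⁻¹ with hc
  set d : ℝ := (√(L ^ 2 * a))⁻¹ with hd
  have hc2 : c * c * (L ^ 2 * a / 2) = 1 := by
    rw [hc, ← mul_inv, Real.mul_self_sqrt (by positivity), inv_mul_cancel₀ (by positivity)]
  have hd2 : d * d * (L ^ 2 * a) = 1 := by
    rw [hd, ← mul_inv, Real.mul_self_sqrt hV.le, inv_mul_cancel₀ hV.ne']
  have hc0 : (c : ℂ) ≠ 0 := by
    have : c ≠ 0 := fun h => by simp [h] at hc2
    exact_mod_cast this
  have hd0 : (d : ℂ) ≠ 0 := by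
    have : d ≠ 0 := fun h => by simp [h] at hd2
    exact_mod_cast this
  let E : ((ℤ × ℤ) × ℕ) × Fin 2 → Hphys L a := fun k => ⟨electricField hL a k.1.1 (k.1.2 + 1)
    (u k.1.1 k.1.2 k.2), electricField_mem_Hphys hL ha (hu2 _ _ _) fun h => by simp at h⟩
  let F : {m : ℤ × ℤ // m ≠ 0} → Hphys L a := fun m => ⟨electricField hL a m 0 normalVec,
    electricField_mem_Hphys hL ha (gradDirection_zero_inner_normalVec L a m) fun h => m.2 h.1⟩
  let w : ModeIndex → Hphys L a := Sum.elim (fun k => (c : ℂ) • E k) fun m => (d : ℂ) • F m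
  have hEE : ∀ k l, ⟪(E k : L2Field L a), E l⟫_ℂ
      = if k = l then ((L ^ 2 * a / 2 : ℝ) : ℂ) else 0 := by
    rintro ⟨⟨m, n⟩, i⟩ ⟨⟨m', n'⟩, j⟩
    change ⟪electricField hL a m (n + 1) (u m n i), electricField hL a m' (n' + 1) (u m' n' j)⟫_ℂ = _
    by_cases h : m = m' ∧ n = n'
    · obtain ⟨rfl, rfl⟩ := h
      rw [inner_electricField_succ hL ha, orthonormal_iff_ite.1 (hu1 m n)]
      simp
    · rw [inner_electricField_of_ne hL ha _ _ (by simpa using h), if_neg]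
      simp only [Prod.mk.injEq]
      tauto
  have hEF : ∀ k m, ⟪(E k : L2Field L a), F m⟫_ℂ = 0 := fun k m =>
    inner_electricField_of_ne hL ha _ _ (by simp)
  have hFE : ∀ m k, ⟪(F m : L2Field L a), E k⟫_ℂ = 0 := fun m k =>
    inner_electricField_of_ne hL ha _ _ (by simp)
  have hFF : ∀ m m', ⟪(F m : L2Field L a), F m'⟫_ℂ
      = if m = m' then ((L ^ 2 * a : ℝ) : ℂ) else 0 := by
    intro m m'
    by_cases h : m = m'
    · subst h
      rw [if_pos rfl]
      exact inner_electricField_zero hL ha m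
    · rw [if_neg h]
      exact inner_electricField_of_ne hL ha _ _ fun h' => h (Subtype.ext h'.1)
  have hw : Orthonormal ℂ w := by
    rw [orthonormal_iff_ite]
    rintro (k | m) (l | m')
    · change ⟪(c : ℂ) • (E k : L2Field L a), (c : ℂ) • (E l : L2Field L a)⟫_ℂ = _
      rw [inner_smul_left, inner_smul_right, hEE, Complex.conj_ofReal]
      by_cases h : k = l
      · simp only [h, if_true]
        exact_mod_cast (by linarith : c * (c * (L ^ 2 * a / 2)) = 1)
      · simp [h]
    · change ⟪(c : ℂ) • (E k : L2Field L a), (d : ℂ) • (F m' : L2Field L a)⟫_ℂ = _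
      rw [inner_smul_left, inner_smul_right, hEF]
      simp
    · change ⟪(d : ℂ) • (F m : L2Field L a), (c : ℂ) • (E l : L2Field L a)⟫_ℂ = _
      rw [inner_smul_left, inner_smul_right, hFE]
      simp
    · change ⟪(d : ℂ) • (F m : L2Field L a), (d : ℂ) • (F m' : L2Field L a)⟫_ℂ = _
      rw [inner_smul_left, inner_smul_right, hFF, Complex.conj_ofReal]
      by_cases h : m = m'
      · simp only [h, if_true]
        exact_mod_cast (by linarith : d * (d * (L ^ 2 * a)) = 1)
      · simp [h]
  have hcomplete : (Submodule.span ℂ (range w))ᗮ = ⊥ := by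
    rw [Submodule.eq_bot_iff]
    intro G hG
    have hGw : ∀ k, ⟪w k, G⟫_ℂ = 0 := fun k => hG _ (Submodule.subset_span ⟨k, rfl⟩)
    have hGE : ∀ k, ⟪(E k : L2Field L a), G⟫_ℂ = 0 := by
      intro k
      have h : ⟪(c : ℂ) • (E k : L2Field L a), G⟫_ℂ = 0 := hGw (Sum.inl k)
      rw [inner_smul_left, Complex.conj_ofReal] at h
      exact (mul_eq_zero.1 h).resolve_left hc0
    have hGF : ∀ m, ⟪(F m : L2Field L a), G⟫_ℂ = 0 := by
      intro m
      have h : ⟪(d : ℂ) • (F m : L2Field L a), G⟫_ℂ = 0 := hGw (Sum.inr m)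
      rw [inner_smul_left, Complex.conj_ofReal] at h
      exact (mul_eq_zero.1 h).resolve_left hd0
    refine Subtype.ext (eq_zero_of_inner_electricField hL ha (fun m n p => ?_) fun m => ?_)
    -- The polarizations whose mode is orthogonal to `G` form a subspace. It contains the gradient
    -- direction, because `G` is divergence free, and both transverse polarizations, by assumption
    -- on `G`; so it is everything.
    · have hS := hu3 m n ((ℂ ∙ (G : L2Field L a))ᗮ.comap (electricField hL a m (n + 1))) ?_ ?_
      · have : p ∈ (ℂ ∙ (G : L2Field L a))ᗮ.comap (electricField hL a m (n + 1)) := by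
          rw [hS]; trivial
        exact (Submodule.mem_orthogonal_singleton_iff_inner_left).1 this
      · exact (Submodule.mem_orthogonal_singleton_iff_inner_left).2
          (inner_electricField_gradDirection_eq_zero hL ha m (n + 1)
            (isWeaklyDivFree_of_mem_HPEC G.2.1))
      · exact fun i => (Submodule.mem_orthogonal_singleton_iff_inner_left).2 (hGE ((m, n), i))
    -- The normal mode with `m = 0` is not in the basis; orthogonality to it is part of membership
    -- in `Hphys`.
    · by_cases hm : m = 0
      · subst hm
        have h := (Submodule.mem_orthogonal_singleton_iff_inner_right).1 G.2.2
        rw [staticMode_eq_smul hL, inner_smul_left, Complex.conj_ofReal] at h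
        exact (mul_eq_zero.1 h).resolve_left hd0
      · exact hGF ⟨m, hm⟩
  refine ⟨HilbertBasis.mkOfOrthogonalEqBot hw hcomplete, fun k => ?_⟩
  rw [HilbertBasis.coe_mkOfOrthogonalEqBot]
  have scale : ∀ (b lam : ℂ) (x : Hphys L a), (x, lam • x) ∈ maxwellGraph L a →
      (b • x, lam • b • x) ∈ maxwellGraph L a := by
    intro b lam x hx
    rw [smul_comm]
    exact Submodule.smul_mem _ b hx
  rcases k with k | m
  · refine scale c _ (E k) ?_
    have := electricField_mem_maxwellGraph hL ha (hu2 k.1.1 k.1.2 k.2) (E k).2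
    simpa only [Nat.cast_add, Nat.cast_one, maxwellEigenvalue, Sum.elim_inl, nu] using this
  · refine scale d _ (F m) ?_
    have := electricField_mem_maxwellGraph hL ha (gradDirection_zero_inner_normalVec L a m) (F m).2
    have h0 : kSq L m + nu a (0 : ℕ) ^ 2 = kSq L m := by simp [nu]
    rw [h0] at this
    exact this

/-! ### From the eigenbasis to the trace -/

theorem apply_eq_inv_smul_of_apply_add_smul {H : Type*} [NormedAddCommGroup H]
    [InnerProductSpace ℂ H] {R : H →L[ℂ] H} {x : H} {l : ℝ} (hl : 0 ≤ l)
    (h : R (x + (l : ℂ) • x) = x) : R x = (l + 1)⁻¹ • x := by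
  have h1 : x + (l : ℂ) • x = ((l + 1 : ℝ) : ℂ) • x := by push_cast; module
  have hne : ((l + 1 : ℝ) : ℂ) ≠ 0 := by
    have : l + 1 ≠ 0 := by linarith
    exact_mod_cast this
  rw [h1, map_smul] at h
  rw [← Complex.coe_smul, Complex.ofReal_inv, eq_inv_smul_iff₀ hne, h]

section ResolventCalculus

variable {H : Type*} [NormedAddCommGroup H] [InnerProductSpace ℂ H] [CompleteSpace H]

theorem spectrum_subset_Icc_of_isPositive {R : H →L[ℂ] H} (hR : R.IsPositive) (hn : ‖R‖ ≤ 1) :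
    spectrum ℝ R ⊆ Icc 0 1 := by
  -- The bound of the spectrum by the norm needs `‖1‖ = 1`, which fails on the zero space; there the
  -- spectrum is empty.
  rcases subsingleton_or_nontrivial H with hH | hH
  · intro t ht
    have : Subsingleton (H →L[ℂ] H) := ⟨fun S T => by ext x; exact Subsingleton.elim _ _⟩
    rw [spectrum.of_subsingleton] at ht
    exact ht.elim
  · intro t ht
    exact ⟨spectrum_nonneg_of_nonneg ((ContinuousLinearMap.nonneg_iff_isPositive R).2 hR) ht,
      (le_abs_self t).trans ((spectrum.norm_le_norm_of_mem ht).trans hn)⟩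

/-- The function `f(A)` of a nonnegative operator with an orthonormal eigenbasis is positive, and its
trace is the sum of the values of `f` at the eigenvalues. -/
theorem functionOf_isPositive_and_traceIn {A : H →ₗ.[ℂ] H} (hpos : (resolventAt A (-1)).IsPositive)
    (hn : ‖resolventAt A (-1)‖ ≤ 1) {κ : Type*} (v : HilbertBasis κ ℂ H) {lam : κ → ℝ}
    (hlam : ∀ k, 0 ≤ lam k) (hv : ∀ k, resolventAt A (-1) (v k) = (lam k + 1)⁻¹ • v k)
    {f : ℝ → ℝ} (hf : ContinuousOn f (Ici 0)) (hf0 : ∀ l, 0 ≤ l → 0 ≤ f l)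
    (hlim : Filter.Tendsto f Filter.atTop (nhds 0)) {ι : Type*} (b : HilbertBasis ι ℂ H) :
    (functionOf A f).IsPositive ∧
      traceIn b (functionOf A f) = ∑' k, ENNReal.ofReal (f (lam k)) := by
  have hspec := spectrum_subset_Icc_of_isPositive hpos hn
  have hsa : IsSelfAdjoint (resolventAt A (-1)) := hpos.isSelfAdjoint
  have hP : (functionOf A f).IsPositive := by
    rw [← ContinuousLinearMap.nonneg_iff_isPositive]
    refine cfc_nonneg fun t ht => ?_
    split_ifs with h
    · exact le_rfl
    · have h01 := hspec ht
      have := (one_le_inv₀ (lt_of_le_of_ne h01.1 (Ne.symm h))).2 h01.2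
      exact hf0 _ (by linarith)
  refine ⟨hP, traceIn_eq_tsum_eigenvalues b v hP.isSelfAdjoint (fun k => hf0 _ (hlam k)) fun k => ?_⟩
  have hk : 0 < lam k + 1 := by linarith [hlam k]
  refine (cfc_apply_of_apply_eq_smul hsa (hv k)
    ((continuousOn_resolvent_symbol hf hlim).mono hspec)).trans ?_
  -- At the resolvent eigenvalue `1 / (λ + 1)`, which is never zero, the symbol takes the value `f
  -- λ`.
  rw [if_neg (inv_ne_zero hk.ne'), inv_inv, add_sub_cancel_right]

theorem norm_comp_adjoint_le_one {K : Type*} [NormedAddCommGroup K] [InnerProductSpace ℂ K]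
    [CompleteSpace K] {J : K →L[ℂ] H} (h : ‖J‖ ≤ 1) : ‖J.comp J.adjoint‖ ≤ 1 := by
  refine (ContinuousLinearMap.opNorm_comp_le _ _).trans ?_
  rw [LinearIsometryEquiv.norm_map]
  exact mul_le_one₀ h (norm_nonneg _) h

end ResolventCalculus

theorem norm_physEmbedding_le (L a : ℝ) : ‖physEmbedding L a‖ ≤ 1 := by
  refine ContinuousLinearMap.opNorm_le_bound _ zero_le_one fun q => ?_
  rw [one_mul]
  change ‖q.1.fst‖ ≤ ‖q.1‖
  have := WithLp.prod_norm_sq_eq_of_L2 q.1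
  exact abs_le_of_sq_le_sq' (by nlinarith [sq_nonneg ‖q.1.snd‖]) (norm_nonneg _) |>.2

theorem resolventAt_maxwellOperator_isPositive {L a : ℝ} (hL : 0 < L) (ha : 0 < a) :
    (resolventAt (maxwellOperator L a) (-1)).IsPositive := by
  rw [resolventAt_maxwellOperator hL ha]
  exact ContinuousLinearMap.isPositive_self_comp_adjoint _

theorem norm_resolventAt_maxwellOperator_le {L a : ℝ} (hL : 0 < L) (ha : 0 < a) :
    ‖resolventAt (maxwellOperator L a) (-1)‖ ≤ 1 := by
  rw [resolventAt_maxwellOperator hL ha]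
  exact norm_comp_adjoint_le_one (norm_physEmbedding_le L a)

theorem resolventAt_maxwellOperator_apply {L a : ℝ} (hL : 0 < L) (ha : 0 < a) {x : Hphys L a}
    {l : ℝ} (hl : 0 ≤ l) (hx : (x, (l : ℂ) • x) ∈ maxwellGraph L a) :
    resolventAt (maxwellOperator L a) (-1) x = (l + 1)⁻¹ • x := by
  rw [resolventAt_maxwellOperator hL ha]
  exact apply_eq_inv_smul_of_apply_add_smul hl ((mem_maxwellGraph_iff L a _ _).1 hx)

/-- The eigenvalue does not depend on the polarization, so the sum over `Fin 2` contributes the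
factor 2. -/
theorem tsum_maxwellEigenvalue (L a : ℝ) (g : ℝ → ℝ≥0∞) :
    ∑' k, g (maxwellEigenvalue L a k)
      = 2 * ∑' (m : ℤ × ℤ) (n : ℕ), g (kSq L m + nu a (n + 1) ^ 2)
        + ∑' m : {m : ℤ × ℤ // m ≠ 0}, g (kSq L m) := by
  rw [Summable.tsum_sum (f := fun k => g (maxwellEigenvalue L a k)) ENNReal.summable
    ENNReal.summable]
  congr 1
  rw [ENNReal.tsum_prod', ENNReal.tsum_prod']
  simp only [maxwellEigenvalue, Sum.elim_inl, tsum_fintype, Finset.sum_const, Finset.card_univ,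
    Fintype.card_fin, nsmul_eq_mul, ENNReal.tsum_mul_left]
  norm_num

theorem functionOf_maxwellOperator {L a : ℝ} (hL : 0 < L) (ha : 0 < a) {f : ℝ → ℝ}
    (hf : ContinuousOn f (Ici 0)) (hf0 : ∀ l, 0 ≤ l → 0 ≤ f l)
    (hlim : Filter.Tendsto f Filter.atTop (nhds 0)) {ι : Type*}
    (b : HilbertBasis ι ℂ (Hphys L a)) :
    (functionOf (maxwellOperator L a) f).IsPositive ∧
      traceIn b (functionOf (maxwellOperator L a) f)
        = 2 * ∑' (m : ℤ × ℤ) (n : ℕ), ENNReal.ofReal (f (kSq L m + nu a (n + 1) ^ 2))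
          + ∑' m : {m : ℤ × ℤ // m ≠ 0}, ENNReal.ofReal (f (kSq L m)) := by
  obtain ⟨v, hv⟩ := exists_maxwell_eigenbasis hL ha
  have h := functionOf_isPositive_and_traceIn (resolventAt_maxwellOperator_isPositive hL ha)
    (norm_resolventAt_maxwellOperator_le hL ha) v (maxwellEigenvalue_nonneg L a)
    (fun k => resolventAt_maxwellOperator_apply hL ha (maxwellEigenvalue_nonneg L a k) (hv k))
    hf hf0 hlim b
  exact ⟨h.1, h.2.trans (tsum_maxwellEigenvalue L a fun l => ENNReal.ofReal (f l))⟩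

end

end MaxwellSlab

theorem proposition3p5 (L a τ : ℝ) (hL : 0 < L) (ha : 0 < a) (hτ : 0 < τ)
    {ι : Type*} (b : HilbertBasis ι ℂ (MaxwellSlab.Hphys L a)) :
    (∀ p : ℝ, 0 ≤ p →
      (MaxwellSlab.heatPower L a p τ).IsPositive ∧
      MaxwellSlab.traceIn b (MaxwellSlab.heatPower L a p τ) < ⊤ ∧
      MaxwellSlab.traceIn b (MaxwellSlab.heatPower L a p τ) =
        2 * ∑' (m : ℤ × ℤ) (n : ℕ),
            ENNReal.ofReal ((MaxwellSlab.kSq L m + MaxwellSlab.nu a (n + 1) ^ 2) ^ p *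
              Real.exp (-(τ * (MaxwellSlab.kSq L m + MaxwellSlab.nu a (n + 1) ^ 2)))) +
          ∑' m : {m : ℤ × ℤ // m ≠ 0},
            ENNReal.ofReal (MaxwellSlab.kSq L m ^ p *
              Real.exp (-(τ * MaxwellSlab.kSq L m)))) ∧
    MaxwellSlab.traceIn b (MaxwellSlab.functionOf (MaxwellSlab.maxwellOperator L a)
      fun l => Real.exp (-(τ * l))) < ⊤ ∧
    MaxwellSlab.traceIn b (MaxwellSlab.heatPower L a (1 / 2) τ) < ⊤ ∧
    MaxwellSlab.traceIn b (MaxwellSlab.heatPower L a (3 / 2) τ) < ⊤ := by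

  have key : ∀ p : ℝ, 0 ≤ p →
      (MaxwellSlab.heatPower L a p τ).IsPositive ∧
      MaxwellSlab.traceIn b (MaxwellSlab.heatPower L a p τ) < ⊤ ∧
      MaxwellSlab.traceIn b (MaxwellSlab.heatPower L a p τ) =
        2 * ∑' (m : ℤ × ℤ) (n : ℕ),
            ENNReal.ofReal ((MaxwellSlab.kSq L m + MaxwellSlab.nu a (n + 1) ^ 2) ^ p *
              Real.exp (-(τ * (MaxwellSlab.kSq L m + MaxwellSlab.nu a (n + 1) ^ 2)))) +
          ∑' m : {m : ℤ × ℤ // m ≠ 0},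
            ENNReal.ofReal (MaxwellSlab.kSq L m ^ p *
              Real.exp (-(τ * MaxwellSlab.kSq L m))) := by
    intro p hp
    obtain ⟨h1, h2⟩ := MaxwellSlab.functionOf_maxwellOperator hL ha
      (MaxwellSlab.continuous_heatPower_symbol hp τ).continuousOn
      (fun l hl => mul_nonneg (Real.rpow_nonneg hl p) (Real.exp_pos _).le)
      (MaxwellSlab.tendsto_heatPower_symbol p hτ) b
    refine ⟨h1, ?_, h2⟩
    refine h2.trans_lt (ENNReal.add_lt_top.2 ⟨ENNReal.mul_lt_top (by simp)
      (MaxwellSlab.tsum_transverse_lt_top hL ha hp hτ), MaxwellSlab.tsum_lateral_lt_top hL hp hτ⟩)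
  refine ⟨key, ?_, (key _ (by norm_num)).2.1, (key _ (by norm_num)).2.1⟩
  -- The heat operator is the case `p = 0`; since `l ^ 0 = 1` also at `l = 0`, the two symbols
  -- coincide as functions.
  have h := (key 0 le_rfl).2.1
  simpa only [MaxwellSlab.heatPower, Real.rpow_zero, one_mul] using h
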